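/- Let $E$ be a separable real Banach space with norm $|\cdot|$, and let ${\rm UC}_{\rm b}$ be the set of bounded uniformly continuous functions $E\to\mathbb{R}$ with the pointwise order. Let $c\colon E\to[0,\infty]$ be convex with $c(0)=0$ and $\lim_{|a|\to\infty}c(a)/|a|=\infty$. Let $(\Omega,\mathcal F,(\mathcal F_t)_{t\ge0},\mathbb P)$ be a filtered probability space (no completeness or right-continuity is assumed) and $(Y_t)_{t\ge0}$ an $E$-valued Lévy process on it: $Y$ is adapted, $Y_0=0$ a.s., $Y_t-Y_s$ is independent of $\mathcal F_s$ for $s\le t$, $Y_{s+t}-Y_s$ has the same law as $Y_t$ for all $s,t\ge 0$, and $Y$ is continuous in probability. Let $\mu_t$ be the law of $Y_t$ for $t>0$. For $f\in{\rm UC}_{\rm b}$, $x\in E$ and $t>0$ put \[ (\Phi_tf)(x)=\sup_{a\in E}\big(f(x+a)-t\,c(a/t)\big),\qquad (\mu_tf)(x)=\int_E f(x+y)\,\mu_t(dy), \] \[ I_tf=\mu_t\Phi_tf,\qquad J_tf=\Phi_t\mu_tf, \] and $\Phi_0f=I_0f=J_0f=f$. Let $\mathcal A$ be the set of all adapted,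 jointly measurable processes $\alpha\colon[0,\infty)\times\Omega\to E$ with $\int_0^t|\alpha_u|\,du<\infty$ for all $t\ge0$, $\mathbb P$-a.s., and for $t\ge 0$ put \[ (V_tf)(x)=\sup_{\alpha\in\mathcal A}\mathbb E\Big[f\Big(x+Y_t+\int_0^t\alpha_u\,du\Big)-\int_0^tc(\alpha_u)\,du\Big], \] where the expectation is $-\infty$ if $\mathbb E\big[\int_0^tc(\alpha_u)\,du\big]=\infty$ (if $c$ is not Borel measurable, the integrals of $c(\alpha_u)$ are understood as lower integrals). All these operators map ${\rm UC}_{\rm b}$ to itself. Then, for all $s,t\ge0$ and $f\in{\rm UC}_{\rm b}$, \[ \Phi_{s+t}f=\Phi_s\Phi_tf,\qquad J_{s+t}f\le J_sJ_tf,\qquad I_{s+t}f\ge I_sI_tf,\qquad V_{s+t}f=V_sV_tf . \] -/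

import Mathlib

open MeasureTheory ProbabilityTheory Filter Topology Bornology
open scoped NNReal ENNReal BoundedContinuousFunction

noncomputable section

namespace HopfLax

/-- The space `UC_b` of bounded uniformly continuous functions `E → ℝ`. It inherits the pointwise
order and the supremum distance from `E →ᵇ ℝ`. -/
abbrev UCb (E : Type*) [PseudoMetricSpace E] : Type _ := {f : E →ᵇ ℝ // UniformContinuous f}

instance {E : Type*} [PseudoMetricSpace E] : CoeFun (UCb E) (fun _ => E → ℝ) := ⟨fun f => f.1⟩

/-- A function that is bounded and uniformly continuous, as an element of `UC_b`. -/
def UCb.mk {E : Type*} [PseudoMetricSpace E] (f : E → ℝ)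
    (hf : UniformContinuous f ∧ ∃ C : ℝ, ∀ x, |f x| ≤ C) : UCb E :=
  ⟨BoundedContinuousFunction.ofNormedAddCommGroup f hf.1.continuous hf.2.choose
    hf.2.choose_spec, hf.1⟩

@[simp] theorem UCb.mk_apply {E : Type*} [PseudoMetricSpace E] (f : E → ℝ)
    (hf : UniformContinuous f ∧ ∃ C : ℝ, ∀ x, |f x| ≤ C) (x : E) : UCb.mk f hf x = f x := rfl

/-! ### A criterion for suprema to define elements of `UC_b` -/

section Sup

variable {E : Type*} [PseudoMetricSpace E] {ι : Type*} {g : ι → E → ℝ} {κ : ι → ℝ≥0∞} {C : ℝ}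

theorem sup_bounds (hC : ∀ i x, |g i x| ≤ C) (hκ : ∃ i, κ i = 0) (x : E) :
    ((-C : ℝ) : EReal) ≤ ⨆ i, ((g i x : EReal) - (κ i : EReal)) ∧
      (⨆ i, ((g i x : EReal) - (κ i : EReal))) ≤ (C : EReal) := by
  constructor
  · obtain ⟨i, hi⟩ := hκ
    refine le_trans ?_ (le_iSup _ i)
    rw [hi]
    rw [EReal.coe_ennreal_zero, sub_zero, EReal.coe_le_coe_iff]
    exact (abs_le.1 (hC i x)).1
  · refine iSup_le fun i => ?_
    calc (g i x : EReal) - (κ i : EReal) ≤ (C : EReal) - 0 :=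
          EReal.sub_le_sub (EReal.coe_le_coe_iff.2 (abs_le.1 (hC i x)).2) (EReal.coe_ennreal_nonneg _)
      _ = C := by simp

theorem coe_toReal_sup (hC : ∀ i x, |g i x| ≤ C) (hκ : ∃ i, κ i = 0) (x : E) :
    ((⨆ i, ((g i x : EReal) - (κ i : EReal))).toReal : EReal) =
      ⨆ i, ((g i x : EReal) - (κ i : EReal)) := by
  obtain ⟨h₁, h₂⟩ := sup_bounds hC hκ x
  exact EReal.coe_toReal (ne_top_of_le_ne_top (EReal.coe_ne_top C) h₂)
    (ne_bot_of_le_ne_bot (EReal.coe_ne_bot _) h₁)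

theorem sup_mem_UCb (hC : ∀ i x, |g i x| ≤ C) (hκ : ∃ i, κ i = 0)
    (hg : ∀ ε > 0, ∃ δ > 0, ∀ x y, dist x y < δ → ∀ i, |g i x - g i y| ≤ ε) :
    UniformContinuous (fun x => (⨆ i, ((g i x : EReal) - (κ i : EReal))).toReal) ∧
      ∃ B : ℝ, ∀ x, |(⨆ i, ((g i x : EReal) - (κ i : EReal))).toReal| ≤ B := by
  have key : ∀ (ε : ℝ) (x y : E), (∀ i, |g i x - g i y| ≤ ε) →
      (⨆ i, ((g i x : EReal) - (κ i : EReal))).toReal ≤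
        (⨆ i, ((g i y : EReal) - (κ i : EReal))).toReal + ε := by
    intro ε x y h
    rw [← EReal.coe_le_coe_iff, EReal.coe_add, coe_toReal_sup hC hκ, coe_toReal_sup hC hκ]
    refine iSup_le fun i => ?_
    calc (g i x : EReal) - (κ i : EReal) ≤ ((g i y + ε : ℝ) : EReal) - (κ i : EReal) := by
          refine EReal.sub_le_sub (EReal.coe_le_coe_iff.2 ?_) le_rfl
          linarith [(abs_le.1 (h i)).2]
      _ = ((g i y : EReal) - (κ i : EReal)) + (ε : EReal) := by
          rw [EReal.coe_add, sub_eq_add_neg, sub_eq_add_neg, add_right_comm]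
      _ ≤ _ := by gcongr; exact le_iSup (fun i => (g i y : EReal) - (κ i : EReal)) i
  refine ⟨?_, C, fun x => ?_⟩
  · rw [Metric.uniformContinuous_iff]
    intro ε hε
    obtain ⟨δ, hδ, h⟩ := hg (ε / 2) (half_pos hε)
    refine ⟨δ, hδ, fun {x y} hxy => ?_⟩
    have h₁ := key _ x y (h x y hxy)
    have h₂ := key _ y x (h y x (by rwa [dist_comm]))
    rw [Real.dist_eq]
    refine lt_of_le_of_lt (abs_le.2 ⟨?_, ?_⟩) (half_lt_self hε) <;> linarith
  · obtain ⟨h₁, h₂⟩ := sup_bounds hC hκ x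
    rw [← coe_toReal_sup hC hκ, EReal.coe_le_coe_iff] at h₁ h₂
    exact abs_le.2 ⟨h₁, h₂⟩

end Sup

section Basic

variable {E : Type*} [NormedAddCommGroup E]

theorem UCb.abs_le (f : UCb E) (x : E) : |f x| ≤ ‖f.1‖ := f.1.norm_coe_le_norm x

theorem UCb.exists_modulus (f : UCb E) (ε : ℝ) (hε : 0 < ε) :
    ∃ δ > 0, ∀ x y, dist x y < δ → ∀ z, |f (x + z) - f (y + z)| ≤ ε := by
  obtain ⟨δ, hδ, h⟩ := Metric.uniformContinuous_iff.1 f.2 ε hε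
  refine ⟨δ, hδ, fun x y hxy z => ?_⟩
  have := h (a := x + z) (b := y + z) (by simpa using hxy)
  rw [Real.dist_eq] at this
  exact this.le

theorem abs_integral_le {Ω : Type*} [MeasurableSpace Ω] (P : Measure Ω) [IsProbabilityMeasure P]
    (f : UCb E) (X : Ω → E) (x : E) : |∫ ω, f (x + X ω) ∂P| ≤ ‖f.1‖ := by
  have := norm_integral_le_of_norm_le_const (μ := P) (f := fun ω => f (x + X ω)) (C := ‖f.1‖)
    (ae_of_all _ fun ω => f.abs_le _)
  simpa using this

theorem abs_integral_sub_le {Ω : Type*} [MeasurableSpace Ω] (P : Measure Ω)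
    [IsProbabilityMeasure P] (f : UCb E) (X : Ω → E) (hX : AEStronglyMeasurable X P) (x y : E)
    (ε : ℝ) (h : ∀ z, |f (x + z) - f (y + z)| ≤ ε) :
    |∫ ω, f (x + X ω) ∂P - ∫ ω, f (y + X ω) ∂P| ≤ ε := by
  have hi : ∀ x : E, Integrable (fun ω => f (x + X ω)) P := fun x =>
    Integrable.of_bound (f.1.continuous.comp_aestronglyMeasurable (hX.const_add x)) ‖f.1‖
      (ae_of_all _ fun ω => f.abs_le _)
  rw [← integral_sub (hi x) (hi y)]
  have := norm_integral_le_of_norm_le_const (μ := P)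
    (f := fun ω => f (x + X ω) - f (y + X ω)) (C := ε) (ae_of_all _ fun ω => h _)
  simpa using this

end Basic

/-! ### Cost functions and the Hopf-Lax operators -/

/-- A convex function `c : E → [0, ∞]` with `c 0 = 0` and superlinear growth. -/
structure IsCost {E : Type*} [NormedAddCommGroup E] [NormedSpace ℝ E] (c : E → ℝ≥0∞) : Prop where
  convex : ConvexOn ℝ≥0 Set.univ c
  zero : c 0 = 0
  superlinear : Tendsto (fun a => c a / ‖a‖ₑ) (cobounded E) (𝓝 ∞)

section HopfLaxOperator

variable {E : Type*} [NormedAddCommGroup E] [NormedSpace ℝ E]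

/-- `sup_{a ∈ E} (f (x + a) - t c (a / t))`, as an extended real number (for `t > 0`). -/
def hopfLaxSup (c : E → ℝ≥0∞) (t : ℝ≥0) (f : E → ℝ) (x : E) : EReal :=
  ⨆ a : E, ((f (x + a) : EReal) - ((t * c (t⁻¹ • a) : ℝ≥0∞) : EReal))

/-- The supremum is finite. -/
theorem coe_toReal_hopfLaxSup {c : E → ℝ≥0∞} (hc : IsCost c) (t : ℝ≥0) (f : UCb E) (x : E) :
    ((hopfLaxSup c t f x).toReal : EReal) = hopfLaxSup c t f x :=
  coe_toReal_sup (g := fun (a x : E) => f (x + a)) (fun _ _ => f.abs_le _)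
    ⟨0, by simp [hc.zero]⟩ x

theorem hopfLaxSup_mem {c : E → ℝ≥0∞} (hc : IsCost c) (t : ℝ≥0) (f : UCb E) :
    UniformContinuous (fun x => (hopfLaxSup c t f x).toReal) ∧
      ∃ B : ℝ, ∀ x, |(hopfLaxSup c t f x).toReal| ≤ B :=
  sup_mem_UCb (g := fun (a x : E) => f (x + a)) (fun _ _ => f.abs_le _)
    ⟨0, by simp [hc.zero]⟩ f.exists_modulus

/-- The Hopf-Lax operator `Φ_t : UC_b → UC_b`, with `Φ_0 f = f`. -/
def Φ {c : E → ℝ≥0∞} (hc : IsCost c) (t : ℝ≥0) (f : UCb E) : UCb E :=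
  if t = 0 then f else UCb.mk (fun x => (hopfLaxSup c t f x).toReal) (hopfLaxSup_mem hc t f)

end HopfLaxOperator

section Compositions

variable {E : Type*} [NormedAddCommGroup E] [TopologicalSpace.SeparableSpace E]
  [MeasurableSpace E] [BorelSpace E]

theorem transition_mem (μ : ProbabilityMeasure E) (f : UCb E) :
    UniformContinuous (fun x => ∫ y, f (x + y) ∂(μ : Measure E)) ∧
      ∃ B : ℝ, ∀ x, |∫ y, f (x + y) ∂(μ : Measure E)| ≤ B := by
  have : SecondCountableTopology E := UniformSpace.secondCountable_of_separable E
  refine ⟨?_, ‖f.1‖, fun x => abs_integral_le _ f (fun y => y) x⟩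
  rw [Metric.uniformContinuous_iff]
  intro ε hε
  obtain ⟨δ, hδ, h⟩ := f.exists_modulus (ε / 2) (half_pos hε)
  refine ⟨δ, hδ, fun {x y} hxy => ?_⟩
  rw [Real.dist_eq]
  exact lt_of_le_of_lt (abs_integral_sub_le _ f (fun y => y)
    continuous_id.aestronglyMeasurable x y _ (h x y hxy)) (half_lt_self hε)

/-- The operator `(μ f)(x) = ∫ f (x + y) μ(dy)` on `UC_b`. -/
def transition (μ : ProbabilityMeasure E) (f : UCb E) : UCb E :=
  UCb.mk (fun x => ∫ y, f (x + y) ∂(μ : Measure E)) (transition_mem μ f)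

variable [NormedSpace ℝ E]

/-- `I_t f = μ_t Φ_t f`, with `I_0 f = f`. -/
def I {c : E → ℝ≥0∞} (hc : IsCost c) (μ : ℝ≥0 → ProbabilityMeasure E) (t : ℝ≥0) (f : UCb E) :
    UCb E :=
  if t = 0 then f else transition (μ t) (Φ hc t f)

/-- `J_t f = Φ_t μ_t f`, with `J_0 f = f`. -/
def J {c : E → ℝ≥0∞} (hc : IsCost c) (μ : ℝ≥0 → ProbabilityMeasure E) (t : ℝ≥0) (f : UCb E) :
    UCb E :=
  if t = 0 then f else Φ hc t (transition (μ t) f)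

end Compositions

/-! ### Lévy processes, admissible controls and the value function -/

section Control

variable {Ω : Type*} {m : MeasurableSpace Ω} {E : Type*} [NormedAddCommGroup E]

/-- `Y` is an `E`-valued Lévy process on the filtered probability space `(Ω, m, 𝓕, P)`: it is
adapted, starts at `0`, has stationary increments that are independent of the past, and is
continuous in probability. -/
structure IsLevyProcess [MeasurableSpace E] (𝓕 : Filtration ℝ≥0 m) (P : Measure Ω)
    (Y : ℝ≥0 → Ω → E) : Prop where
  adapted : StronglyAdapted 𝓕 Y
  zero : ∀ᵐ ω ∂P, Y 0 ω = 0
  indep : ∀ s t, s ≤ t → Indep (MeasurableSpace.comap (Y t - Y s) inferInstance) (𝓕 s) P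
  stationary : ∀ s t, IdentDistrib (Y (s + t) - Y s) (Y t) P P
  tendstoInMeasure : ∀ t, TendstoInMeasure P Y (𝓝 t) (Y t)

/-- The set `𝒜` of admissible controls: adapted (jointly measurable) processes with almost surely
locally integrable paths. Times `u ≥ 0` are embedded into `ℝ` for integration. -/
def admissible (𝓕 : Filtration ℝ≥0 m) (P : Measure Ω) : Set (ℝ≥0 → Ω → E) :=
  {α | StronglyAdapted 𝓕 α ∧ StronglyMeasurable (Function.uncurry α) ∧
    ∀ᵐ ω ∂P, ∀ t : ℝ≥0, IntegrableOn (fun u : ℝ => α u.toNNReal ω) (Set.Ioc 0 (t : ℝ))}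

variable [NormedSpace ℝ E]

/-- The controlled dynamics `Y_t^{x,α} = x + Y_t + ∫_0^t α_u du`; written as
`x + (Y_t + ∫_0^t α_u du)`. -/
def controlled (Y α : ℝ≥0 → Ω → E) (t : ℝ≥0) (x : E) (ω : Ω) : E :=
  x + (Y t ω + ∫ u in Set.Ioc 0 (t : ℝ), α u.toNNReal ω)

/-- The expected running cost `𝔼[∫_0^t c(α_u) du] ∈ [0, ∞]`. -/
def runningCost (c : E → ℝ≥0∞) (P : Measure Ω) (α : ℝ≥0 → Ω → E) (t : ℝ≥0) : ℝ≥0∞ :=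
  ∫⁻ ω, (∫⁻ u in Set.Ioc 0 (t : ℝ), c (α u.toNNReal ω)) ∂P

/-- `sup_{α ∈ 𝒜} 𝔼[f(Y_t^{x,α}) - ∫_0^t c(α_u) du]`. As `f` is bounded and `c ≥ 0`, the expectation
is the difference of `𝔼[f(Y_t^{x,α})] ∈ ℝ` and `𝔼[∫_0^t c(α_u) du] ∈ [0, ∞]`. -/
def valueSup (c : E → ℝ≥0∞) (𝓕 : Filtration ℝ≥0 m) (P : Measure Ω) (Y : ℝ≥0 → Ω → E) (t : ℝ≥0)
    (f : E → ℝ) (x : E) : EReal :=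
  ⨆ α : admissible (E := E) 𝓕 P,
    (((∫ ω, f (controlled Y α t x ω) ∂P : ℝ) : EReal) - (runningCost c P α t : EReal))

theorem exists_runningCost_eq_zero {c : E → ℝ≥0∞} (hc : IsCost c) (𝓕 : Filtration ℝ≥0 m)
    (P : Measure Ω) (t : ℝ≥0) :
    ∃ α : admissible (E := E) 𝓕 P, runningCost c P α t = 0 :=
  ⟨⟨fun _ _ => 0, fun _ => stronglyMeasurable_const, stronglyMeasurable_const, by simp⟩,
    by simp [runningCost, hc.zero]⟩

/-- The supremum is finite. -/
theorem coe_toReal_valueSup {c : E → ℝ≥0∞} (hc : IsCost c) (𝓕 : Filtration ℝ≥0 m) (P : Measure Ω)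
    [IsProbabilityMeasure P] (Y : ℝ≥0 → Ω → E) (t : ℝ≥0) (f : UCb E) (x : E) :
    ((valueSup c 𝓕 P Y t f x).toReal : EReal) = valueSup c 𝓕 P Y t f x :=
  coe_toReal_sup
    (g := fun (α : admissible (E := E) 𝓕 P) (x : E) => ∫ ω, f (controlled Y α t x ω) ∂P)
    (fun _ x => abs_integral_le P f _ x) (exists_runningCost_eq_zero hc 𝓕 P t) x

theorem valueSup_mem [MeasurableSpace E] {c : E → ℝ≥0∞} (hc : IsCost c)
    {𝓕 : Filtration ℝ≥0 m} {P : Measure Ω} [IsProbabilityMeasure P] {Y : ℝ≥0 → Ω → E}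
    (hY : IsLevyProcess 𝓕 P Y) (t : ℝ≥0) (f : UCb E) :
    UniformContinuous (fun x => (valueSup c 𝓕 P Y t f x).toReal) ∧
      ∃ B : ℝ, ∀ x, |(valueSup c 𝓕 P Y t f x).toReal| ≤ B := by
  refine sup_mem_UCb
    (g := fun (α : admissible (E := E) 𝓕 P) (x : E) => ∫ ω, f (controlled Y α t x ω) ∂P)
    (fun _ x => abs_integral_le P f _ x) (exists_runningCost_eq_zero hc 𝓕 P t) ?_
  intro ε hε
  obtain ⟨δ, hδ, h⟩ := f.exists_modulus ε hε
  refine ⟨δ, hδ, fun x y hxy α => ?_⟩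
  refine abs_integral_sub_le P f _ ?_ x y ε (h x y hxy)
  refine (((hY.adapted t).mono (𝓕.le t)).add ?_).aestronglyMeasurable
  have h₁ : StronglyMeasurable (fun p : Ω × ℝ => (α : ℝ≥0 → Ω → E) p.2.toNNReal p.1) :=
    α.2.2.1.comp_measurable ((measurable_real_toNNReal.comp measurable_snd).prodMk measurable_fst)
  exact h₁.integral_prod_right

/-- The value function `V_t : UC_b → UC_b` of the drift control problem. -/
def V [MeasurableSpace E] {c : E → ℝ≥0∞} (hc : IsCost c)
    {𝓕 : Filtration ℝ≥0 m} {P : Measure Ω} [IsProbabilityMeasure P] {Y : ℝ≥0 → Ω → E}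
    (hY : IsLevyProcess 𝓕 P Y) (t : ℝ≥0) (f : UCb E) : UCb E :=
  UCb.mk (fun x => (valueSup c 𝓕 P Y t f x).toReal) (valueSup_mem hc hY t f)

end Control

end HopfLax

end

/-!
Convexity of `c` makes the Hopf-Lax operators `Φ_t` a semigroup, and the `μ_t` form one by the Lévy
property. Anticipating the noise can only help, so `Φ_s μ_t ≤ μ_t Φ_s`, and this single inequality
yields both the one for `J` and the one for `I`.

For the value function, one time step of length `h` is bounded on both sides. Choosing a constant
control from the current state, before the noise is known, gives `V_s Φ_h μ_h ≤ V_{s+h}`; revealing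
the next increment of `Y` to the controller and averaging the control over the step (Jensen) gives
`V_{s+h} ≤ V_s μ_h Φ_h`. Hence `V_{s+nh} f` lies between `V_s` applied to `(Φ_h μ_h)^n f` and to
`(μ_h Φ_h)^n f`. As `(μ_h Φ_h)^(n+1) = μ_h (Φ_h μ_h)^n Φ_h`, these iterates differ only by single
factors `μ_h` and `Φ_h`, and everything is translation invariant and monotone, so the difference
tends to `0` with `h`, uniformly in `n`. With `h = t / n`, both `V_{s+t} f` and `V_s V_t f` are
squeezed.
-/

namespace HopfLax

/-! ### Bounded uniformly continuous functions -/

theorem UCb.ext {E : Type*} [PseudoMetricSpace E] {f g : UCb E} (h : ∀ x, f x = g x) : f = g :=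
  Subtype.ext (BoundedContinuousFunction.ext h)

theorem UCb.abs_sub_le {E : Type*} [PseudoMetricSpace E] (f : UCb E) (x y : E) :
    |f x - f y| ≤ 2 * ‖f.1‖ :=
  f.1.dist_le_two_norm x y

theorem UCb.exists_abs_add_sub_le {E : Type*} [NormedAddCommGroup E] (f : UCb E) {ε : ℝ}
    (hε : 0 < ε) : ∃ δ > 0, ∀ z, ‖z‖ < δ → ∀ x, |f (x + z) - f x| ≤ ε := by
  obtain ⟨δ, hδ, hf⟩ := f.exists_modulus ε hε
  refine ⟨δ, hδ, fun z hz x => ?_⟩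
  simpa using hf (x + z) x (by simpa using hz) 0

theorem UCb.integrable_comp {E : Type*} [PseudoMetricSpace E] {Ω : Type*} [MeasurableSpace Ω]
    {P : Measure Ω} [IsFiniteMeasure P] (f : UCb E) {X : Ω → E} (hX : AEStronglyMeasurable X P) :
    Integrable (fun ω => f (X ω)) P :=
  Integrable.of_bound (f.1.continuous.comp_aestronglyMeasurable hX) ‖f.1‖
    (ae_of_all _ fun _ => f.1.norm_coe_le_norm _)

/-! ### Monotone operators commuting with translations -/

section EquivariantMonotone

variable {E : Type*} [NormedAddCommGroup E] {S T A B : UCb E → UCb E} {f g : UCb E} {ε r : ℝ}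

/-- Operators on `UC_b` that are monotone, commute with translations and do not increase by more
than `r` when `r` is added to the argument. The three properties are packed into one implication,
which makes it evident that `T f` inherits every modulus of continuity of `f`. -/
def IsEquivariantMonotone (T : UCb E → UCb E) : Prop :=
  ∀ (f g : UCb E) (z : E) (r : ℝ), (∀ x, f (x + z) ≤ g x + r) → ∀ x, T f (x + z) ≤ T g x + r

namespace IsEquivariantMonotone

theorem id : IsEquivariantMonotone (id : UCb E → UCb E) := fun _ _ _ _ h => h

theorem comp (hS : IsEquivariantMonotone S) (hT : IsEquivariantMonotone T) :
    IsEquivariantMonotone (S ∘ T) :=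
  fun f g z r h => hS _ _ z r (hT f g z r h)

theorem iterate (hT : IsEquivariantMonotone T) (n : ℕ) : IsEquivariantMonotone T^[n] := by
  induction n with
  | zero => exact id
  | succ n ih => exact ih.comp hT

theorem le_add (hT : IsEquivariantMonotone T) (h : ∀ x, f x ≤ g x + r) (x : E) :
    T f x ≤ T g x + r := by
  simpa using hT f g 0 r (by simpa using h) x

theorem monotone (hT : IsEquivariantMonotone T) : Monotone T := fun f g h x => by
  have h_le : ∀ y, f y ≤ g y + 0 := fun y => (h y).trans_eq (add_zero _).symm
  simpa using hT.le_add h_le x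

theorem abs_add_sub_le (hT : IsEquivariantMonotone T) {z : E}
    (h : ∀ x, |f (x + z) - f x| ≤ r) (x : E) : |T f (x + z) - T f x| ≤ r := by
  have h_right := hT f f z r (fun x => by linarith [(abs_le.1 (h x)).2]) x
  have h_left := hT f f (-z) r
    (fun x => by have := (abs_le.1 (h (x + -z))).1; rw [neg_add_cancel_right] at this; linarith)
    (x + z)
  rw [add_neg_cancel_right] at h_left
  exact abs_le.2 ⟨by linarith, by linarith⟩

/-- The two iterations differ by one factor at each end:
`(A ∘ B)^[n + 1] = A ∘ (B ∘ A)^[n] ∘ B`. -/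
theorem iterate_comp_le_iterate_comp_add (hA : IsEquivariantMonotone A)
    (hB : IsEquivariantMonotone B) (hB_near : ∀ x, B f x ≤ f x + ε) (hle_B : ∀ g, g ≤ B g)
    (hA_near : ∀ T, IsEquivariantMonotone T → ∀ x, |A (T f) x - T f x| ≤ ε) (n : ℕ) (x : E) :
    (A ∘ B)^[n] f x ≤ (B ∘ A)^[n] f x + 3 * ε := by
  have hε : 0 ≤ ε := (abs_nonneg _).trans (hA_near _ id x)
  cases n with
  | zero => simpa using hε
  | succ n =>
    set K := (B ∘ A)^[n]
    have hK : IsEquivariantMonotone K := (hB.comp hA).iterate n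
    have h_factor : (A ∘ B)^[n + 1] f = A (K (B f)) :=
      have h : Function.Semiconj A (B ∘ A) (A ∘ B) := fun _ => rfl
      (h.iterate_right n (B f)).symm
    have h_near : ∀ y, f y ≤ B (A f) y + ε := fun y => by
      have hf := (abs_le.1 (hA_near _ id y)).1
      have hAf : A f y ≤ B (A f) y := hle_B (A f) y
      simp only [id_eq] at hf
      linarith
    have hK_near := (abs_le.1 (hA_near K hK x)).2
    calc (A ∘ B)^[n + 1] f x = A (K (B f)) x := by rw [h_factor]
      _ ≤ A (K f) x + ε := hA.le_add (hK.le_add hB_near) x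
      _ ≤ K f x + 2 * ε := by linarith
      _ ≤ K (B (A f)) x + ε + 2 * ε := by gcongr; exact hK.le_add h_near x
      _ = (B ∘ A)^[n + 1] f x + 3 * ε := by
        rw [Function.iterate_succ_apply, Function.comp_apply]
        ring

end IsEquivariantMonotone

end EquivariantMonotone

/-! ### The Hopf-Lax semigroup -/

section ConvexCost

variable {E : Type*} [AddCommMonoid E] [Module ℝ≥0 E] {c : E → ℝ≥0∞}

theorem exists_convex_combination_toReal_le (hc : ConvexOn ℝ≥0 Set.univ c) (s t : ℝ≥0) {a b : E}
    (ha : c a ≠ ∞) (hb : c b ≠ ∞) :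
    ∃ d, c d ≠ ∞ ∧ (s + t) • d = s • a + t • b ∧
      (s + t : ℝ) * (c d).toReal ≤ s * (c a).toReal + t * (c b).toReal := by
  rcases eq_or_ne (s + t) 0 with h | h
  · obtain ⟨rfl, rfl⟩ := add_eq_zero.1 h
    exact ⟨a, ha, by simp, by simp⟩
  have h_conv := hc.2 (Set.mem_univ a) (Set.mem_univ b)
    (zero_le (a := s / (s + t))) (zero_le (a := t / (s + t))) (by rw [← add_div, div_self h])
  simp only [ENNReal.smul_def, smul_eq_mul] at h_conv
  refine ⟨_, ne_top_of_le_ne_top (by finiteness) h_conv, ?_, ?_⟩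
  · rw [smul_add, smul_smul, smul_smul, mul_div_cancel₀ _ h, mul_div_cancel₀ _ h]
  have h_real := ENNReal.toReal_mono (by finiteness) h_conv
  rw [ENNReal.toReal_add (by finiteness) (by finiteness), ENNReal.toReal_mul,
    ENNReal.toReal_mul, ENNReal.coe_toReal, ENNReal.coe_toReal] at h_real
  push_cast at h_real
  have h_pos : (0 : ℝ) < s + t := by exact_mod_cast pos_iff_ne_zero.2 h
  calc _ ≤ (s + t : ℝ) * (s / (s + t) * (c a).toReal + t / (s + t) * (c b).toReal) := by gcongr
    _ = _ := by field_simp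

end ConvexCost

section SuperlinearCost

variable {E : Type*} [NormedAddCommGroup E] {c : E → ℝ≥0∞}

theorem eventually_mul_enorm_le
    (hc : Tendsto (fun a => c a / ‖a‖ₑ) (cobounded E) (𝓝 ∞)) (K : ℝ≥0) :
    ∀ᶠ a in cobounded E, K * ‖a‖ₑ ≤ c a := by
  filter_upwards [hc.eventually (lt_mem_nhds (ENNReal.coe_lt_top (r := K)))] with a ha
  exact ENNReal.mul_le_of_le_div ha.le

variable [NormedSpace ℝ E]

theorem eventually_le_mul_of_le_nnnorm_smul
    (hc : Tendsto (fun a => c a / ‖a‖ₑ) (cobounded E) (𝓝 ∞)) (M : ℝ≥0) {δ : ℝ≥0} (hδ : 0 < δ) :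
    ∀ᶠ t : ℝ≥0 in 𝓝 0, ∀ b, δ ≤ ‖t • b‖₊ → M ≤ t * c b := by
  obtain ⟨R, -, hR⟩ :=
    hasBasis_cobounded_norm.eventually_iff.1 (eventually_mul_enorm_le hc (M / δ))
  have h_small : ∀ᶠ t : ℝ≥0 in 𝓝 0, t * R.toNNReal < δ :=
    (tendsto_id.mul_const R.toNNReal).eventually_lt_const (by simpa using hδ)
  filter_upwards [h_small] with t ht b hb
  have h_norm : ‖t • b‖₊ = t * ‖b‖₊ := by rw [NNReal.smul_def, nnnorm_smul, NNReal.nnnorm_eq]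
  rw [h_norm] at hb
  have h_large : R ≤ ‖b‖ := by
    by_contra! h_lt
    have h_le : ‖b‖₊ ≤ R.toNNReal := NNReal.le_toNNReal_of_coe_le h_lt.le
    exact ((hb.trans (by gcongr)).trans_lt ht).false
  have h_scale : M ≤ t * (M / δ * ‖b‖₊) := by
    calc M = M / δ * δ := (div_mul_cancel₀ _ hδ.ne').symm
      _ ≤ M / δ * (t * ‖b‖₊) := by gcongr
      _ = t * (M / δ * ‖b‖₊) := by ring
  calc (M : ℝ≥0∞) ≤ t * (((M / δ : ℝ≥0) : ℝ≥0∞) * ‖b‖ₑ) := by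
        rw [enorm_eq_nnnorm]; exact_mod_cast h_scale
    _ ≤ t * c b := by gcongr; exact hR h_large

end SuperlinearCost

section HopfLaxSemigroup

variable {E : Type*} [NormedAddCommGroup E] [NormedSpace ℝ E] {c : E → ℝ≥0∞}

theorem coe_Φ (hc : IsCost c) {t : ℝ≥0} (ht : t ≠ 0) (f : UCb E) (x : E) :
    ((Φ hc t f x : ℝ) : EReal) = hopfLaxSup c t f x := by
  rw [Φ, if_neg ht, UCb.mk_apply, coe_toReal_hopfLaxSup hc]

theorem coe_sub_coe_mul_ennreal (r : ℝ) (t : ℝ≥0) {y : ℝ≥0∞} (hy : y ≠ ∞) :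
    (r : EReal) - ((t * y : ℝ≥0∞) : EReal) = ((r - t * y.toReal : ℝ) : EReal) := by
  lift y to ℝ≥0 using hy
  norm_cast

theorem le_Φ (hc : IsCost c) (t : ℝ≥0) (f : UCb E) (x : E) {b : E} (hb : c b ≠ ∞) :
    f (x + t • b) - t * (c b).toReal ≤ Φ hc t f x := by
  rcases eq_or_ne t 0 with rfl | ht
  · simp [Φ]
  rw [← EReal.coe_le_coe_iff, coe_Φ hc ht, ← coe_sub_coe_mul_ennreal _ _ hb]
  refine le_trans ?_ (le_iSup _ (t • b))
  rw [inv_smul_smul₀ ht]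

theorem Φ_le (hc : IsCost c) (t : ℝ≥0) (f : UCb E) (x : E) {r : ℝ}
    (h : ∀ b, c b ≠ ∞ → f (x + t • b) - t * (c b).toReal ≤ r) : Φ hc t f x ≤ r := by
  rcases eq_or_ne t 0 with rfl | ht
  · simpa [Φ, hc.zero] using h 0
  rw [← EReal.coe_le_coe_iff, coe_Φ hc ht]
  refine iSup_le fun a => ?_
  by_cases ha : c (t⁻¹ • a) = ∞
  · simp [ha, ENNReal.mul_top, ht]
  · have h_le := h _ ha
    rw [smul_inv_smul₀ ht] at h_le
    rw [coe_sub_coe_mul_ennreal _ _ ha]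
    exact_mod_cast h_le

theorem exists_lt_Φ (hc : IsCost c) (t : ℝ≥0) (f : UCb E) (x : E) {ε : ℝ} (hε : 0 < ε) :
    ∃ b, c b ≠ ∞ ∧ Φ hc t f x - ε < f (x + t • b) - t * (c b).toReal := by
  by_contra! h
  linarith [Φ_le hc t f x h]

theorem self_le_Φ (hc : IsCost c) (t : ℝ≥0) (f : UCb E) : f ≤ Φ hc t f := fun x => by
  simpa [hc.zero] using le_Φ hc t f x (b := 0) (by simp [hc.zero])

theorem isEquivariantMonotone_Φ (hc : IsCost c) (t : ℝ≥0) : IsEquivariantMonotone (Φ hc t) := by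
  intro f g z r h x
  refine Φ_le hc _ _ _ fun b hb => ?_
  have hf := h (x + t • b)
  have hg := le_Φ hc t g x hb
  rw [add_right_comm] at hf
  linarith

theorem Φ_add (hc : IsCost c) (s t : ℝ≥0) (f : UCb E) : Φ hc (s + t) f = Φ hc s (Φ hc t f) := by
  refine UCb.ext fun x => le_antisymm ?_ ?_
  · refine Φ_le hc _ _ _ fun b hb => ?_
    have hs := le_Φ hc s (Φ hc t f) x hb
    have ht := le_Φ hc t f (x + s • b) hb
    rw [add_assoc, ← add_smul] at ht
    push_cast
    linarith
  · refine Φ_le hc _ _ _ fun a ha => ?_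
    rw [sub_le_iff_le_add]
    refine Φ_le hc _ _ _ fun b hb => ?_
    obtain ⟨d, hd, hd_eq, hd_le⟩ := exists_convex_combination_toReal_le hc.convex s t ha hb
    have h := le_Φ hc (s + t) f x hd
    rw [hd_eq, ← add_assoc] at h
    push_cast at h
    linarith

theorem eventually_Φ_le_add (hc : IsCost c) (f : UCb E) {ε : ℝ} (hε : 0 < ε) :
    ∀ᶠ t in 𝓝 (0 : ℝ≥0), ∀ x, Φ hc t f x ≤ f x + ε := by
  obtain ⟨δ, hδ, hf⟩ := f.exists_abs_add_sub_le hε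
  lift δ to ℝ≥0 using hδ.le
  filter_upwards [eventually_le_mul_of_le_nnnorm_smul hc.superlinear (2 * ‖f.1‖₊)
    (NNReal.coe_pos.1 hδ)] with t ht x
  refine Φ_le hc _ _ _ fun b hb => ?_
  rcases lt_or_ge ‖t • b‖₊ δ with h_near | h_far
  · have h_cost : 0 ≤ (t : ℝ) * (c b).toReal := by positivity
    linarith [(abs_le.1 (hf _ h_near x)).2]
  · have h_cost := ENNReal.toReal_mono (by finiteness) (ht b h_far)
    simp only [ENNReal.coe_toReal, ENNReal.toReal_mul, NNReal.coe_mul, NNReal.coe_ofNat,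
      coe_nnnorm] at h_cost
    linarith [(abs_le.1 (f.abs_sub_le (x + t • b) x)).2]

end HopfLaxSemigroup

/-! ### Transition operators and the operators `I` and `J` -/

section Transition

variable {E : Type*} [NormedAddCommGroup E] [TopologicalSpace.SeparableSpace E]
  [MeasurableSpace E] [BorelSpace E]

theorem UCb.integrable_add (μ : Measure E) [IsFiniteMeasure μ] (f : UCb E) (x : E) :
    Integrable (fun y => f (x + y)) μ :=
  have : SecondCountableTopology E := UniformSpace.secondCountable_of_separable E
  f.integrable_comp (by fun_prop)

theorem transition_apply (μ : ProbabilityMeasure E) (f : UCb E) (x : E) :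
    transition μ f x = ∫ y, f (x + y) ∂(μ : Measure E) := rfl

theorem isEquivariantMonotone_transition (μ : ProbabilityMeasure E) :
    IsEquivariantMonotone (transition μ) := by
  intro f g z r h x
  have h_add : transition μ g x + r = ∫ y, (g (x + y) + r) ∂(μ : Measure E) := by
    simp [integral_add (g.integrable_add μ x) (integrable_const r), transition_apply]
  rw [h_add, transition_apply]
  refine integral_mono (f.integrable_add μ _)
    ((g.integrable_add μ x).add (integrable_const r)) fun y => ?_
  simpa [add_right_comm] using h (x + y)

theorem abs_transition_sub_le (μ : ProbabilityMeasure E) {f : UCb E} {x : E} {δ ε C : ℝ}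
    (hε : 0 ≤ ε) (h_near : ∀ z, ‖z‖ < δ → |f (x + z) - f x| ≤ ε)
    (h_far : ∀ z, |f (x + z) - f x| ≤ C) :
    |transition μ f x - f x| ≤ ε + C * (μ : Measure E).real {y | δ ≤ ‖y‖} := by
  have hm : MeasurableSet {y : E | δ ≤ ‖y‖} := measurableSet_le measurable_const measurable_norm
  have hC : Integrable ({y : E | δ ≤ ‖y‖}.indicator fun _ => C) (μ : Measure E) :=
    (integrable_const C).indicator hm
  calc |transition μ f x - f x|
      = ‖∫ y, (f (x + y) - f x) ∂(μ : Measure E)‖ := by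
        simp [integral_sub (f.integrable_add μ x) (integrable_const _), transition_apply]
    _ ≤ ∫ y, (ε + {y : E | δ ≤ ‖y‖}.indicator (fun _ => C) y) ∂(μ : Measure E) := by
        refine norm_integral_le_of_norm_le ((integrable_const ε).add hC) (ae_of_all _ fun y => ?_)
        by_cases hy : δ ≤ ‖y‖
        · simpa [hy] using (h_far y).trans (le_add_of_nonneg_left hε)
        · simpa [hy] using h_near y (not_le.1 hy)
    _ = ε + C * (μ : Measure E).real {y | δ ≤ ‖y‖} := by
        rw [integral_add (integrable_const _) hC, integral_indicator_const _ hm]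
        simp [mul_comm]

theorem transition_eq_of_eq_conv {μ ν ρ : ProbabilityMeasure E}
    (h : (ρ : Measure E) = (μ : Measure E) ∗ (ν : Measure E)) (f : UCb E) :
    transition ρ f = transition μ (transition ν f) := by
  have : SecondCountableTopology E := UniformSpace.secondCountable_of_separable E
  refine UCb.ext fun x => ?_
  have h_int := f.integrable_add (ρ : Measure E) x
  rw [h] at h_int
  simp only [transition_apply, h, integral_conv h_int, add_assoc]

variable [NormedSpace ℝ E] {c : E → ℝ≥0∞}

theorem Φ_transition_le (hc : IsCost c) (t : ℝ≥0) (μ : ProbabilityMeasure E) (f : UCb E) :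
    Φ hc t (transition μ f) ≤ transition μ (Φ hc t f) := fun x => by
  refine Φ_le hc _ _ _ fun b hb => ?_
  rw [sub_le_iff_le_add]
  exact isEquivariantMonotone_transition μ f (Φ hc t f) (t • b) (t * (c b).toReal)
    (fun y => by linarith [le_Φ hc t f y hb]) x

theorem J_of_pos (hc : IsCost c) (μ : ℝ≥0 → ProbabilityMeasure E) {t : ℝ≥0} (ht : 0 < t)
    (f : UCb E) : J hc μ t f = Φ hc t (transition (μ t) f) :=
  if_neg ht.ne'

theorem I_of_pos (hc : IsCost c) (μ : ℝ≥0 → ProbabilityMeasure E) {t : ℝ≥0} (ht : 0 < t)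
    (f : UCb E) : I hc μ t f = transition (μ t) (Φ hc t f) :=
  if_neg ht.ne'

variable {μ : ℝ≥0 → ProbabilityMeasure E}

theorem J_add_le (hc : IsCost c)
    (hμ : ∀ s t, 0 < s → 0 < t → (μ (s + t) : Measure E) = (μ s : Measure E) ∗ (μ t : Measure E))
    (s t : ℝ≥0) (f : UCb E) : J hc μ (s + t) f ≤ J hc μ s (J hc μ t f) := by
  rcases eq_zero_or_pos s with rfl | hs
  · simp [J]
  rcases eq_zero_or_pos t with rfl | ht
  · simp [J]
  calc J hc μ (s + t) f = Φ hc s (Φ hc t (transition (μ s) (transition (μ t) f))) := by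
        rw [J_of_pos hc μ (by positivity), Φ_add, transition_eq_of_eq_conv (hμ s t hs ht)]
    _ ≤ Φ hc s (transition (μ s) (Φ hc t (transition (μ t) f))) :=
        (isEquivariantMonotone_Φ hc s).monotone (Φ_transition_le hc t _ _)
    _ = J hc μ s (J hc μ t f) := by rw [J_of_pos hc μ hs, J_of_pos hc μ ht]

theorem I_I_le (hc : IsCost c)
    (hμ : ∀ s t, 0 < s → 0 < t → (μ (s + t) : Measure E) = (μ s : Measure E) ∗ (μ t : Measure E))
    (s t : ℝ≥0) (f : UCb E) : I hc μ s (I hc μ t f) ≤ I hc μ (s + t) f := by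
  rcases eq_zero_or_pos s with rfl | hs
  · simp [I]
  rcases eq_zero_or_pos t with rfl | ht
  · simp [I]
  calc I hc μ s (I hc μ t f) = transition (μ s) (Φ hc s (transition (μ t) (Φ hc t f))) := by
        rw [I_of_pos hc μ hs, I_of_pos hc μ ht]
    _ ≤ transition (μ s) (transition (μ t) (Φ hc s (Φ hc t f))) :=
        (isEquivariantMonotone_transition (μ s)).monotone (Φ_transition_le hc s _ _)
    _ = I hc μ (s + t) f := by
        rw [I_of_pos hc μ (by positivity), Φ_add, transition_eq_of_eq_conv (hμ s t hs ht)]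

end Transition

/-! ### Transition operators for short times -/

section SmallTimes

variable {E : Type*} [NormedAddCommGroup E] [TopologicalSpace.SeparableSpace E]
  [MeasurableSpace E] [BorelSpace E] {μ : ℝ≥0 → ProbabilityMeasure E}

theorem eventually_abs_transition_sub_le
    (hμ : ∀ δ > 0, Tendsto (fun t => (μ t : Measure E).real {y | δ ≤ ‖y‖}) (𝓝[>] 0) (𝓝 0))
    (f : UCb E) {ε : ℝ} (hε : 0 < ε) :
    ∀ᶠ t in 𝓝[>] 0, ∀ T, IsEquivariantMonotone T →
      ∀ x, |transition (μ t) (T f) x - T f x| ≤ ε := by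
  obtain ⟨δ, hδ, hf⟩ := f.exists_abs_add_sub_le (half_pos hε)
  have h_tail : Tendsto (fun t => 2 * ‖f.1‖ * (μ t : Measure E).real {y | δ ≤ ‖y‖})
      (𝓝[>] 0) (𝓝 0) := by
    simpa using (hμ δ hδ).const_mul (2 * ‖f.1‖)
  filter_upwards [h_tail.eventually_le_const (half_pos hε)] with t ht T hT x
  refine (abs_transition_sub_le (μ t) (half_pos hε).le
    (fun z hz => hT.abs_add_sub_le (hf z hz) x)
    fun z => hT.abs_add_sub_le (fun y => f.abs_sub_le (y + z) y) x).trans ?_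
  linarith

variable [NormedSpace ℝ E] {c : E → ℝ≥0∞}

theorem eventually_iterate_transition_comp_Φ_le (hc : IsCost c)
    (hμ : ∀ δ > 0, Tendsto (fun t => (μ t : Measure E).real {y | δ ≤ ‖y‖}) (𝓝[>] 0) (𝓝 0))
    (f : UCb E) {ε : ℝ} (hε : 0 < ε) :
    ∀ᶠ t in 𝓝[>] 0, ∀ n x,
      (transition (μ t) ∘ Φ hc t)^[n] f x ≤ (Φ hc t ∘ transition (μ t))^[n] f x + ε := by
  filter_upwards [eventually_abs_transition_sub_le hμ f (ε := ε / 3) (by positivity),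
    nhdsWithin_le_nhds (eventually_Φ_le_add hc f (ε := ε / 3) (by positivity))] with t hμt hΦt n x
  refine ((isEquivariantMonotone_transition (μ t)).iterate_comp_le_iterate_comp_add
    (isEquivariantMonotone_Φ hc t) hΦt (self_le_Φ hc t) hμt n x).trans_eq ?_
  ring

end SmallTimes

/-! ### Measurability of integrals with respect to a sub-σ-algebra -/

section Measurability

variable {Ω : Type*} {m' m : MeasurableSpace Ω} {P : Measure Ω} {E : Type*} [NormedAddCommGroup E]

theorem aestronglyMeasurable_of_tendsto_ae_of_le [CompleteSpace E] {Z : ℕ → Ω → E} {W : Ω → E}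
    (hZ : ∀ n, AEStronglyMeasurable[m'] (Z n) P)
    (h : ∀ᵐ ω ∂P, Tendsto (fun n => Z n ω) atTop (𝓝 (W ω))) : AEStronglyMeasurable[m'] W P := by
  refine ⟨fun ω => limUnder atTop fun n => (hZ n).mk (Z n) ω,
    @StronglyMeasurable.limUnder _ _ _ m' _ _ _ _ _ _ _ fun n => (hZ n).stronglyMeasurable_mk, ?_⟩
  filter_upwards [h, ae_all_iff.2 fun n => (hZ n).ae_eq_mk] with ω hω hω_mk
  refine (Tendsto.limUnder_eq ?_).symm
  simpa only [← hω_mk] using hω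

variable [NormedSpace ℝ E]

theorem norm_inv_one_add_norm_div_smul_le_norm (x : E) {r : ℝ} (hr : 0 ≤ r) :
    ‖(1 + ‖x‖ / r)⁻¹ • x‖ ≤ ‖x‖ := by
  rw [norm_smul, Real.norm_of_nonneg (by positivity)]
  refine mul_le_of_le_one_left (norm_nonneg x) (inv_le_one_of_one_le₀ ?_)
  exact le_add_of_nonneg_right (by positivity)

theorem norm_inv_one_add_norm_div_smul_le (x : E) {r : ℝ} (hr : 0 < r) :
    ‖(1 + ‖x‖ / r)⁻¹ • x‖ ≤ r := by
  rw [norm_smul, Real.norm_of_nonneg (by positivity), inv_mul_le_iff₀ (by positivity), add_mul,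
    div_mul_cancel₀ _ hr.ne']
  linarith

variable {U : Type*} [MeasurableSpace U] {ν : Measure U} {a : U → Ω → E}

theorem integral_smul_integral_swap [SFinite ν] [SFinite P]
    (ha : Integrable (Function.uncurry a) (ν.prod P))
    {r : Ω → ℝ} {C : ℝ} (hr : AEStronglyMeasurable r P) (hrC : ∀ᵐ ω ∂P, ‖r ω‖ ≤ C) :
    ∫ ω, r ω • ∫ u, a u ω ∂ν ∂P = ∫ u, ∫ ω, r ω • a u ω ∂P ∂ν := by
  have ha_swap : Integrable (fun p : Ω × U => a p.2 p.1) (P.prod ν) := ha.swap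
  simp_rw [← integral_smul]
  exact integral_integral_swap (ha_swap.bdd_smul (φ := fun p : Ω × U => r p.1) C hr.comp_fst
    (Measure.quasiMeasurePreserving_fst.ae hrC))

variable [CompleteSpace E] [IsFiniteMeasure P]

theorem integral_condExp_smul (hm : m' ≤ m) {q : Ω → ℝ} {C : ℝ} (hq : Integrable q P)
    (hqC : ∀ᵐ ω ∂P, ‖q ω‖ ≤ C) {Z : Ω → E} (hZ : Integrable Z P) :
    ∫ ω, (P[q|m']) ω • Z ω ∂P = ∫ ω, q ω • (P[Z|m']) ω ∂P := by
  have h_left : Integrable (P[q|m'] • Z) P :=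
    hZ.bdd_smul C (stronglyMeasurable_condExp.mono hm).aestronglyMeasurable
      (ae_bdd_abs_condExp_of_ae_bdd_abs hqC)
  have h_right : Integrable (q • P[Z|m']) P :=
    integrable_condExp.bdd_smul C hq.aestronglyMeasurable hqC
  calc ∫ ω, (P[q|m']) ω • Z ω ∂P = ∫ ω, (P[P[q|m'] • Z|m']) ω ∂P := (integral_condExp hm).symm
    _ = ∫ ω, (P[q|m'] • P[Z|m']) ω ∂P := integral_congr_ae
        (condExp_smul_of_aestronglyMeasurable_left
          stronglyMeasurable_condExp.aestronglyMeasurable h_left hZ)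
    _ = ∫ ω, (P[q • P[Z|m']|m']) ω ∂P := integral_congr_ae
        (condExp_smul_of_aestronglyMeasurable_right hq h_right
          stronglyMeasurable_condExp.aestronglyMeasurable).symm
    _ = _ := integral_condExp hm

/-- For bounded `q`, self-adjointness of the conditional expectation and Fubini's theorem give
`∫ q • P[Z|m'] = ∫ P[q|m'] • Z = ∫ u, ∫ P[q|m'] • a u = ∫ u, ∫ q • P[a u|m'] = ∫ q • Z` for
`Z = ∫ u, a u ∂ν`. -/
theorem condExp_integral_ae_eq_integral [SFinite ν] (hm : m' ≤ m)
    (ha : Integrable (Function.uncurry a) (ν.prod P))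
    (ha' : ∀ᵐ u ∂ν, StronglyMeasurable[m'] (a u)) :
    P[fun ω => ∫ u, a u ω ∂ν|m'] =ᵐ[P] fun ω => ∫ u, a u ω ∂ν := by
  have hZ : Integrable (fun ω => ∫ u, a u ω ∂ν) P := ha.integral_prod_right
  refine integrable_condExp.ae_eq_of_forall_setIntegral_eq _ _ hZ fun B hB _ => ?_
  set q : Ω → ℝ := B.indicator 1
  have hq : Integrable q P := (integrable_const (1 : ℝ)).indicator hB
  have hq_one : ∀ᵐ ω ∂P, ‖q ω‖ ≤ 1 := ae_of_all _ fun ω =>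
    (norm_indicator_le_norm_self _ _).trans (by simp)
  have h_set (W : Ω → E) : ∫ ω in B, W ω ∂P = ∫ ω, q ω • W ω ∂P := by
    rw [← integral_indicator hB]
    congr 1 with ω
    by_cases h : ω ∈ B <;> simp [q, h]
  rw [h_set, h_set, ← integral_condExp_smul hm hq hq_one hZ,
    integral_smul_integral_swap ha hq.aestronglyMeasurable hq_one,
    integral_smul_integral_swap ha (stronglyMeasurable_condExp.mono hm).aestronglyMeasurable
      (ae_bdd_abs_condExp_of_ae_bdd_abs hq_one)]
  refine integral_congr_ae ?_
  filter_upwards [ha', ha.prod_right_ae] with u hu h_int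
  have hau : Integrable (a u) P := h_int
  rw [integral_condExp_smul hm hq hq_one hau, condExp_of_stronglyMeasurable hm hu hau]

/-- Since `a` need not be jointly measurable with respect to `m'`, the integral is identified with
its own conditional expectation. Truncating `a` makes it integrable on the product space. -/
theorem aestronglyMeasurable_integral [IsFiniteMeasure ν] (hm : m' ≤ m)
    (ha : StronglyMeasurable (Function.uncurry a)) (ha' : ∀ᵐ u ∂ν, StronglyMeasurable[m'] (a u))
    (h_int : ∀ᵐ ω ∂P, Integrable (fun u => a u ω) ν) :
    AEStronglyMeasurable[m'] (fun ω => ∫ u, a u ω ∂ν) P := by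
  let τ (n : ℕ) (x : E) : E := (1 + ‖x‖ / (n + 1 : ℝ))⁻¹ • x
  have hτ (n : ℕ) : Continuous (τ n) :=
    ((by fun_prop : Continuous fun x : E => 1 + ‖x‖ / (n + 1 : ℝ)).inv₀
      fun x => by positivity).smul continuous_id
  have hτ_tendsto (x : E) : Tendsto (fun n => τ n x) atTop (𝓝 x) := by
    have h := (tendsto_one_div_add_atTop_nhds_zero_nat (𝕜 := ℝ)).const_mul ‖x‖
    simpa [τ, div_eq_mul_inv] using ((h.const_add 1).inv₀ (by simp)).smul_const x
  refine aestronglyMeasurable_of_tendsto_ae_of_le (Z := fun n ω => ∫ u, τ n (a u ω) ∂ν)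
    (fun n => ?_) ?_
  · have h_bounded : Integrable (Function.uncurry fun u ω => τ n (a u ω)) (ν.prod P) :=
      Integrable.of_bound ((hτ n).comp_stronglyMeasurable ha).aestronglyMeasurable (n + 1)
        (ae_of_all _ fun p => norm_inv_one_add_norm_div_smul_le _ (by positivity))
    exact ⟨_, stronglyMeasurable_condExp, (condExp_integral_ae_eq_integral hm h_bounded
      (ha'.mono fun u hu => (hτ n).comp_stronglyMeasurable hu)).symm⟩
  · filter_upwards [h_int] with ω hω
    exact tendsto_integral_of_dominated_convergence (fun u => ‖a u ω‖)
      (fun n => (hτ n).comp_aestronglyMeasurable hω.aestronglyMeasurable) hω.norm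
      (fun n => ae_of_all _ fun u => norm_inv_one_add_norm_div_smul_le_norm _ (by positivity))
      (ae_of_all _ fun u => hτ_tendsto _)

end Measurability

/-! ### Increments of Lévy processes -/

section Levy

variable {Ω : Type*} {m : MeasurableSpace Ω} {P : Measure Ω} {E : Type*} [NormedAddCommGroup E]
  [MeasurableSpace E] {𝓕 : Filtration ℝ≥0 m} {Y : ℝ≥0 → Ω → E}

theorem IsLevyProcess.hasLaw_sub (hY : IsLevyProcess 𝓕 P Y) {ν : Measure E} {t : ℝ≥0}
    (hν : HasLaw (Y t) ν P) (s : ℝ≥0) : HasLaw (Y (s + t) - Y s) ν P :=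
  ⟨(hY.stationary s t).aemeasurable_fst, (hY.stationary s t).map_eq.trans hν.map_eq⟩

variable [BorelSpace E]

theorem IsLevyProcess.indepFun_sub (hY : IsLevyProcess 𝓕 P Y) {s t : ℝ≥0} (hst : s ≤ t)
    {X : Ω → E} (hX : AEStronglyMeasurable[𝓕 s] X P) : IndepFun X (Y t - Y s) P := by
  have h_mk : IndepFun (hX.mk X) (Y t - Y s) P := by
    rw [IndepFun_iff_Indep]
    exact (indep_of_indep_of_le_right (hY.indep s t hst)
      hX.stronglyMeasurable_mk.measurable.comap_le).symm
  exact h_mk.congr hX.ae_eq_mk.symm (EventuallyEq.refl _ _)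

theorem IsLevyProcess.tendsto_measureReal (hY : IsLevyProcess 𝓕 P Y)
    {μ : ℝ≥0 → ProbabilityMeasure E} (hμ : ∀ t, 0 < t → HasLaw (Y t) (μ t : Measure E) P) (δ : ℝ)
    (hδ : 0 < δ) : Tendsto (fun t => (μ t : Measure E).real {y | δ ≤ ‖y‖}) (𝓝[>] 0) (𝓝 0) := by
  have h_prob := hY.tendstoInMeasure 0 (ENNReal.ofReal δ) (ENNReal.ofReal_pos.2 hδ)
  have h_real := (ENNReal.tendsto_toReal ENNReal.zero_ne_top).comp
    (h_prob.mono_left (nhdsWithin_le_nhds (s := Set.Ioi 0)))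
  refine h_real.congr' ?_
  filter_upwards [self_mem_nhdsWithin] with t ht
  rw [← (hμ t ht).measureReal_eq (measurableSet_le measurable_const measurable_norm),
    measureReal_def]
  refine congrArg ENNReal.toReal (measure_congr ?_)
  filter_upwards [hY.zero] with ω hω
  refine propext (?_ : ENNReal.ofReal δ ≤ edist (Y t ω) (Y 0 ω) ↔ δ ≤ ‖Y t ω‖)
  rw [hω, edist_zero_right, ← ofReal_norm, ENNReal.ofReal_le_ofReal_iff (norm_nonneg _)]

variable [TopologicalSpace.SeparableSpace E]

theorem integral_comp_add_of_indepFun {X Z : Ω → E} {ν : ProbabilityMeasure E}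
    [IsProbabilityMeasure P] (hXZ : IndepFun X Z P) (hX : AEMeasurable X P)
    (hZ : HasLaw Z (ν : Measure E) P) (f : UCb E) :
    ∫ ω, f (X ω + Z ω) ∂P = ∫ ω, transition ν f (X ω) ∂P := by
  have : SecondCountableTopology E := UniformSpace.secondCountable_of_separable E
  have hX_law : HasLaw X (P.map X) P := ⟨hX, rfl⟩
  have := Measure.isProbabilityMeasure_map hX
  calc ∫ ω, f (X ω + Z ω) ∂P = ∫ y, f y ∂(P.map X ∗ (ν : Measure E)) :=
        (hXZ.hasLaw_add hX_law hZ).integral_comp f.1.continuous.aestronglyMeasurable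
    _ = ∫ x, transition ν f x ∂(P.map X) := integral_conv (f.integrable_comp (by fun_prop))
    _ = ∫ ω, transition ν f (X ω) ∂P :=
        (hX_law.integral_comp (transition ν f).1.continuous.aestronglyMeasurable).symm

namespace IsLevyProcess

theorem hasLaw_add (hY : IsLevyProcess 𝓕 P Y) {ν ρ : Measure E} [SigmaFinite ν] [SigmaFinite ρ]
    {s t : ℝ≥0} (hν : HasLaw (Y s) ν P) (hρ : HasLaw (Y t) ρ P) :
    HasLaw (Y (s + t)) (ν ∗ ρ) P := by
  have : SecondCountableTopology E := UniformSpace.secondCountable_of_separable E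
  have h_indep := hY.indepFun_sub (le_self_add (b := t)) (hY.adapted s).aestronglyMeasurable
  simpa using h_indep.hasLaw_add hν (hY.hasLaw_sub hρ s)

theorem integral_comp_add_sub [IsProbabilityMeasure P] (hY : IsLevyProcess 𝓕 P Y)
    {ν : ProbabilityMeasure E} {t : ℝ≥0} (hν : HasLaw (Y t) (ν : Measure E) P) (s : ℝ≥0)
    (f : UCb E) {X : Ω → E} (hX : AEStronglyMeasurable[𝓕 s] X P) :
    ∫ ω, f (X ω + (Y (s + t) ω - Y s ω)) ∂P = ∫ ω, transition ν f (X ω) ∂P :=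
  integral_comp_add_of_indepFun (hY.indepFun_sub le_self_add hX)
    (hX.mono (𝓕.le s)).aemeasurable (hY.hasLaw_sub hν s) f

end IsLevyProcess

end Levy

/-! ### Jensen's inequality for non-measurable costs -/

section ClosedEpigraph

variable {E : Type*} [TopologicalSpace E] {c : E → ℝ≥0∞} {a : E}

/-- The closure of the epigraph of the finite part of `c`. It is a subset of `E × ℝ` rather than of
`E × ℝ≥0∞`, so that Jensen's inequality for closed convex sets applies. -/
def closedEpigraph (c : E → ℝ≥0∞) : Set (E × ℝ) :=
  closure {p | c p.1 ≠ ∞ ∧ (c p.1).toReal ≤ p.2}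

/-- The lower semicontinuous envelope of `c`, a measurable minorant that replaces a cost which need
not be measurable itself. It is defined by its epigraph, the closure of the epigraph of `c`. -/
noncomputable def lscEnvelope (c : E → ℝ≥0∞) (a : E) : ℝ≥0∞ :=
  ⨅ (r : ℝ≥0) (_ : (a, (r : ℝ)) ∈ closedEpigraph c), (r : ℝ≥0∞)

theorem mem_closedEpigraph_of_le {r r' : ℝ} (h : (a, r) ∈ closedEpigraph c) (hr : r ≤ r') :
    (a, r') ∈ closedEpigraph c := by
  have h_cont : Continuous fun p : E × ℝ => (p.1, p.2 + (r' - r)) := by fun_prop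
  have h_mem := map_mem_closure h_cont h (t := {p | c p.1 ≠ ∞ ∧ (c p.1).toReal ≤ p.2})
    fun p hp => ⟨hp.1, hp.2.trans (le_add_of_nonneg_right (sub_nonneg.2 hr))⟩
  simpa [closedEpigraph] using h_mem

theorem lscEnvelope_le_coe_iff {r : ℝ≥0} :
    lscEnvelope c a ≤ r ↔ (a, (r : ℝ)) ∈ closedEpigraph c := by
  refine ⟨fun h => ?_, fun h => iInf₂_le r h⟩
  have h_above : ∀ r' : ℝ≥0, r < r' → (a, (r' : ℝ)) ∈ closedEpigraph c := fun r' hr' => by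
    have h_lt : lscEnvelope c a < r' := h.trans_lt (ENNReal.coe_lt_coe.2 hr')
    simp only [lscEnvelope, iInf_lt_iff] at h_lt
    obtain ⟨q, hq, hq_lt⟩ := h_lt
    exact mem_closedEpigraph_of_le hq (NNReal.coe_le_coe.2 (ENNReal.coe_lt_coe.1 hq_lt).le)
  have h_lim : Tendsto (fun r' : ℝ≥0 => (a, (r' : ℝ))) (𝓝[>] r) (𝓝 (a, (r : ℝ))) :=
    (by fun_prop : Continuous fun r' : ℝ≥0 => (a, (r' : ℝ))).continuousWithinAt
  exact isClosed_closure.mem_of_tendsto h_lim (eventually_mem_nhdsWithin.mono h_above)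

theorem lscEnvelope_le (c : E → ℝ≥0∞) (a : E) : lscEnvelope c a ≤ c a := by
  by_cases h : c a = ∞
  · simp [h]
  · rw [← ENNReal.coe_toNNReal h, lscEnvelope_le_coe_iff]
    exact subset_closure ⟨h, le_rfl⟩

theorem mem_closedEpigraph_lscEnvelope (h : lscEnvelope c a ≠ ∞) :
    (a, (lscEnvelope c a).toReal) ∈ closedEpigraph c :=
  lscEnvelope_le_coe_iff.1 (ENNReal.coe_toNNReal h).ge

theorem lowerSemicontinuous_lscEnvelope (c : E → ℝ≥0∞) :
    LowerSemicontinuous (lscEnvelope c) := by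
  rw [lowerSemicontinuous_iff_isClosed_preimage]
  intro y
  induction y with
  | top => simp
  | coe r =>
    have h_eq : lscEnvelope c ⁻¹' Set.Iic (r : ℝ≥0∞) =
        (fun a => (a, (r : ℝ))) ⁻¹' closedEpigraph c :=
      Set.ext fun a => lscEnvelope_le_coe_iff
    rw [h_eq]
    exact isClosed_closure.preimage (by fun_prop)

end ClosedEpigraph

section Jensen

variable {E : Type*} [NormedAddCommGroup E] [NormedSpace ℝ E] {c : E → ℝ≥0∞}

theorem convex_closedEpigraph (hc : ConvexOn ℝ≥0 Set.univ c) : Convex ℝ (closedEpigraph c) := by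
  refine Convex.closure fun p hp q hq a b ha hb hab => ?_
  lift a to ℝ≥0 using ha
  lift b to ℝ≥0 using hb
  obtain ⟨d, hd, hd_eq, hd_le⟩ := exists_convex_combination_toReal_le hc a b hp.1 hq.1
  have hab' : a + b = 1 := by exact_mod_cast hab
  rw [hab', one_smul] at hd_eq
  subst hd_eq
  rw [hab, one_mul] at hd_le
  refine ⟨hd, hd_le.trans ?_⟩
  simp only [Prod.snd_add, Prod.smul_snd, smul_eq_mul]
  gcongr
  exacts [hp.2, hq.2]

theorem le_Φ_of_mem_closedEpigraph (hc : IsCost c) (t : ℝ≥0) (f : UCb E) (x : E) {p : E × ℝ}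
    (hp : p ∈ closedEpigraph c) : f (x + t • p.1) - t * p.2 ≤ Φ hc t f x := by
  have hf := f.1.continuous
  have h_closed : IsClosed {p : E × ℝ | f (x + t • p.1) - t * p.2 ≤ Φ hc t f x} :=
    isClosed_le (by fun_prop) continuous_const
  refine closure_minimal (fun q hq => ?_) h_closed hp
  have h_cost : (t : ℝ) * (c q.1).toReal ≤ t * q.2 := by gcongr; exact hq.2
  exact (sub_le_sub_left h_cost _).trans (le_Φ hc t f x hq.1)

variable [CompleteSpace E] [MeasurableSpace E] [BorelSpace E] {U : Type*} [MeasurableSpace U]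
  {ν : Measure U} {α : U → E}

theorem average_mem_closedEpigraph [IsFiniteMeasure ν] [NeZero ν]
    (hc : ConvexOn ℝ≥0 Set.univ c) (hα : Integrable α ν)
    (h_fin : ∫⁻ u, lscEnvelope c (α u) ∂ν ≠ ∞) :
    (⨍ u, α u ∂ν, ⨍ u, (lscEnvelope c (α u)).toReal ∂ν) ∈ closedEpigraph c := by
  have h_meas : AEMeasurable (fun u => lscEnvelope c (α u)) ν :=
    (lowerSemicontinuous_lscEnvelope c).measurable.comp_aemeasurable hα.aemeasurable
  have h_int := integrable_toReal_of_lintegral_ne_top h_meas h_fin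
  rw [← average_pair hα h_int]
  exact (convex_closedEpigraph hc).average_mem isClosed_closure
    ((ae_lt_top' h_meas h_fin).mono fun _ hu => mem_closedEpigraph_lscEnvelope hu.ne)
    (hα.prodMk h_int)

theorem ofReal_sub_Φ_le_lintegral (hc : IsCost c) {t : ℝ≥0} (f : UCb E) (x : E)
    (hν : ν Set.univ = t) (hα : Integrable α ν) :
    ENNReal.ofReal (f (x + ∫ u, α u ∂ν) - Φ hc t f x) ≤ ∫⁻ u, c (α u) ∂ν := by
  rcases eq_or_ne t 0 with rfl | ht
  · simp [Measure.measure_univ_eq_zero.1 hν, Φ]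
  have : IsFiniteMeasure ν := ⟨by rw [hν]; exact ENNReal.coe_lt_top⟩
  have : NeZero ν := ⟨fun h => ht (by simpa [h] using hν.symm)⟩
  refine le_trans ?_ (lintegral_mono fun u => lscEnvelope_le c (α u))
  by_cases h_fin : ∫⁻ u, lscEnvelope c (α u) ∂ν = ∞
  · simp [h_fin]
  have h_meas : AEMeasurable (fun u => lscEnvelope c (α u)) ν :=
    (lowerSemicontinuous_lscEnvelope c).measurable.comp_aemeasurable hα.aemeasurable
  have h_jensen :=
    le_Φ_of_mem_closedEpigraph hc t f x (average_mem_closedEpigraph hc.convex hα h_fin)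
  have hνr : ν.real Set.univ = t := by rw [measureReal_def, hν, ENNReal.coe_toReal]
  have ht' : (t : ℝ) ≠ 0 := by exact_mod_cast ht
  rw [average_eq, average_eq, hνr, NNReal.smul_def, smul_inv_smul₀ ht', smul_eq_mul,
    mul_inv_cancel_left₀ ht', integral_toReal h_meas (ae_lt_top' h_meas h_fin)] at h_jensen
  rw [ENNReal.ofReal_le_iff_le_toReal h_fin]
  linarith

end Jensen

/-! ### The value function -/

section Ioc

theorem lintegral_Ioc_add (s t : ℝ≥0) (k : ℝ → ℝ≥0∞) :
    ∫⁻ u in Set.Ioc 0 ((s + t : ℝ≥0) : ℝ), k u =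
      (∫⁻ u in Set.Ioc 0 (s : ℝ), k u) + ∫⁻ u in Set.Ioc (s : ℝ) ((s + t : ℝ≥0) : ℝ), k u := by
  rw [← lintegral_union measurableSet_Ioc (Set.Ioc_disjoint_Ioc_of_le le_rfl),
    Set.Ioc_union_Ioc_eq_Ioc s.coe_nonneg (NNReal.coe_le_coe.2 le_self_add)]

theorem integral_Ioc_add {E : Type*} [NormedAddCommGroup E] [NormedSpace ℝ E] (s t : ℝ≥0)
    {k : ℝ → E} (hk : IntegrableOn k (Set.Ioc 0 ((s + t : ℝ≥0) : ℝ))) :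
    ∫ u in Set.Ioc 0 ((s + t : ℝ≥0) : ℝ), k u =
      (∫ u in Set.Ioc 0 (s : ℝ), k u) + ∫ u in Set.Ioc (s : ℝ) ((s + t : ℝ≥0) : ℝ), k u := by
  rw [← Set.Ioc_union_Ioc_eq_Ioc s.coe_nonneg (NNReal.coe_le_coe.2 (le_self_add (b := t)))] at hk ⊢
  exact setIntegral_union (Set.Ioc_disjoint_Ioc_of_le le_rfl) measurableSet_Ioc hk.left_of_union
    hk.right_of_union

theorem volume_Ioc_add (s t : ℝ≥0) : volume (Set.Ioc (s : ℝ) ((s + t : ℝ≥0) : ℝ)) = t := by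
  simp [Real.volume_Ioc]

end Ioc

section Controlled

variable {Ω : Type*} {m : MeasurableSpace Ω} {P : Measure Ω} [IsFiniteMeasure P]
  {E : Type*} [NormedAddCommGroup E] [NormedSpace ℝ E] [CompleteSpace E]
  {𝓕 : Filtration ℝ≥0 m} {Y α : ℝ≥0 → Ω → E}

theorem aestronglyMeasurable_controlled (hY : StronglyAdapted 𝓕 Y)
    (hα : α ∈ admissible (E := E) 𝓕 P) (t : ℝ≥0) (x : E) :
    AEStronglyMeasurable[𝓕 t] (controlled Y α t x) P := by
  have h_joint : StronglyMeasurable (Function.uncurry fun (u : ℝ) ω => α u.toNNReal ω) :=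
    hα.2.1.comp_measurable
      ((measurable_real_toNNReal.comp measurable_fst).prodMk measurable_snd)
  have h_adapted : ∀ᵐ u ∂volume.restrict (Set.Ioc 0 (t : ℝ)),
      StronglyMeasurable[𝓕 t] (α u.toNNReal) :=
    (ae_restrict_iff' measurableSet_Ioc).2 (ae_of_all _ fun u hu =>
      (hα.1 _).mono (𝓕.mono (Real.toNNReal_le_iff_le_coe.2 hu.2)))
  exact ((hY t).aestronglyMeasurable.add (aestronglyMeasurable_integral (𝓕.le t) h_joint h_adapted
    (hα.2.2.mono fun ω hω => hω t))).const_add x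

theorem integrable_comp_controlled (hY : StronglyAdapted 𝓕 Y)
    (hα : α ∈ admissible (E := E) 𝓕 P) (t : ℝ≥0) (f : UCb E) (x : E) :
    Integrable (fun ω => f (controlled Y α t x ω)) P :=
  f.integrable_comp ((aestronglyMeasurable_controlled hY hα t x).mono (𝓕.le t))

end Controlled

section RunningCost

variable {Ω : Type*} {m : MeasurableSpace Ω} {E : Type*} {Y α : ℝ≥0 → Ω → E} {c : E → ℝ≥0∞}

theorem runningCost_add_lintegral_le (c : E → ℝ≥0∞) (P : Measure Ω) (α : ℝ≥0 → Ω → E)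
    (s t : ℝ≥0) :
    runningCost c P α s +
        ∫⁻ ω, (∫⁻ u in Set.Ioc (s : ℝ) ((s + t : ℝ≥0) : ℝ), c (α u.toNNReal ω)) ∂P ≤
      runningCost c P α (s + t) := by
  simp_rw [runningCost, lintegral_Ioc_add s t]
  exact le_lintegral_add _ _

theorem ofReal_controlled_sub_Φ_le_lintegral [NormedAddCommGroup E] [NormedSpace ℝ E]
    [CompleteSpace E] [MeasurableSpace E] [BorelSpace E] (hc : IsCost c) {s t : ℝ≥0} {ω : Ω}
    (hα : IntegrableOn (fun u : ℝ => α u.toNNReal ω) (Set.Ioc 0 ((s + t : ℝ≥0) : ℝ)))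
    (f : UCb E) (x : E) :
    ENNReal.ofReal (f (controlled Y α (s + t) x ω) -
        Φ hc t f (controlled Y α s x ω + (Y (s + t) ω - Y s ω))) ≤
      ∫⁻ u in Set.Ioc (s : ℝ) ((s + t : ℝ≥0) : ℝ), c (α u.toNNReal ω) := by
  have h_eq : controlled Y α (s + t) x ω = controlled Y α s x ω + (Y (s + t) ω - Y s ω) +
      ∫ u in Set.Ioc (s : ℝ) ((s + t : ℝ≥0) : ℝ), α u.toNNReal ω := by
    simp only [controlled, integral_Ioc_add s t hα]
    abel
  rw [h_eq]
  exact ofReal_sub_Φ_le_lintegral hc f _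
    (by rw [Measure.restrict_apply_univ, volume_Ioc_add])
    (hα.mono_set (Set.Ioc_subset_Ioc_left s.coe_nonneg))

end RunningCost

section ValueFunction

variable {Ω : Type*} {m : MeasurableSpace Ω} {P : Measure Ω} [IsProbabilityMeasure P]
  {E : Type*} [NormedAddCommGroup E] [NormedSpace ℝ E] [MeasurableSpace E]
  {𝓕 : Filtration ℝ≥0 m} {Y : ℝ≥0 → Ω → E} {c : E → ℝ≥0∞}

theorem coe_V (hc : IsCost c) (hY : IsLevyProcess 𝓕 P Y) (t : ℝ≥0) (f : UCb E) (x : E) :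
    ((V hc hY t f x : ℝ) : EReal) = valueSup c 𝓕 P Y t f x := by
  rw [V, UCb.mk_apply, coe_toReal_valueSup hc]

theorem le_V (hc : IsCost c) (hY : IsLevyProcess 𝓕 P Y) {α : ℝ≥0 → Ω → E}
    (hα : α ∈ admissible (E := E) 𝓕 P) {t : ℝ≥0} (h_fin : runningCost c P α t ≠ ∞) (f : UCb E)
    (x : E) :
    ∫ ω, f (controlled Y α t x ω) ∂P - (runningCost c P α t).toReal ≤ V hc hY t f x := by
  rw [← EReal.coe_le_coe_iff, coe_V hc hY, EReal.coe_sub, EReal.coe_ennreal_toReal h_fin]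
  exact le_iSup_of_le (⟨α, hα⟩ : admissible (E := E) 𝓕 P) le_rfl

theorem V_le (hc : IsCost c) (hY : IsLevyProcess 𝓕 P Y) {t : ℝ≥0} {f : UCb E} {x : E} {r : ℝ}
    (h : ∀ α ∈ admissible (E := E) 𝓕 P, runningCost c P α t ≠ ∞ →
      ∫ ω, f (controlled Y α t x ω) ∂P - (runningCost c P α t).toReal ≤ r) :
    V hc hY t f x ≤ r := by
  rw [← EReal.coe_le_coe_iff, coe_V hc hY]
  refine iSup_le fun α => ?_
  by_cases h_fin : runningCost c P α t = ∞
  · simp [h_fin]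
  · rw [← EReal.coe_ennreal_toReal h_fin, ← EReal.coe_sub, EReal.coe_le_coe_iff]
    exact h α α.2 h_fin

theorem V_zero (hc : IsCost c) (hY : IsLevyProcess 𝓕 P Y) (f : UCb E) : V hc hY 0 f = f := by
  have h_int (α : ℝ≥0 → Ω → E) (x : E) : ∫ ω, f (controlled Y α 0 x ω) ∂P = f x := by
    have h_ae : (fun ω => f (controlled Y α 0 x ω)) =ᵐ[P] fun _ => f x := by
      filter_upwards [hY.zero] with ω hω
      simp [controlled, hω]
    simp [integral_congr_ae h_ae]
  have h_cost (α : ℝ≥0 → Ω → E) : runningCost c P α 0 = 0 := by simp [runningCost]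
  refine UCb.ext fun x => le_antisymm (V_le hc hY fun α _ _ => ?_) ?_
  · simp [h_int, h_cost]
  · obtain ⟨α, -⟩ := exists_runningCost_eq_zero hc 𝓕 P 0
    simpa [h_int, h_cost] using le_V hc hY α.2 (t := 0) (by simp [h_cost]) f x

variable [CompleteSpace E]

theorem isEquivariantMonotone_V (hc : IsCost c) (hY : IsLevyProcess 𝓕 P Y) (t : ℝ≥0) :
    IsEquivariantMonotone (V hc hY t) := by
  intro f g z r h x
  refine V_le hc hY fun α hα h_fin => ?_
  have hg := integrable_comp_controlled hY.adapted hα t g x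
  have h_le : ∫ ω, f (controlled Y α t (x + z) ω) ∂P ≤
      ∫ ω, (g (controlled Y α t x ω) + r) ∂P := by
    refine integral_mono (integrable_comp_controlled hY.adapted hα t f _)
      (hg.add (integrable_const r)) fun ω => ?_
    simpa only [controlled, add_right_comm] using h (controlled Y α t x ω)
  rw [integral_add hg (integrable_const r)] at h_le
  simp only [integral_const, probReal_univ, one_smul] at h_le
  linarith [le_V hc hY hα h_fin g x]

variable [TopologicalSpace.SeparableSpace E] [BorelSpace E]

/-- After time `s`, a controller who already knows the increment of `Y` over `[s, s + t]` can
replace the drift by its average, which by Jensen's inequality does not cost more. -/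
theorem V_add_le (hc : IsCost c) (hY : IsLevyProcess 𝓕 P Y) {ν : ProbabilityMeasure E} {t : ℝ≥0}
    (hν : HasLaw (Y t) (ν : Measure E) P) (s : ℝ≥0) (f : UCb E) :
    V hc hY (s + t) f ≤ V hc hY s (transition ν (Φ hc t f)) := fun x => by
  have : SecondCountableTopology E := UniformSpace.secondCountable_of_separable E
  refine V_le hc hY fun α hα h_fin => ?_
  let X ω := controlled Y α s x ω + (Y (s + t) ω - Y s ω)
  let k ω := f (controlled Y α (s + t) x ω) - Φ hc t f (X ω)
  have hs := aestronglyMeasurable_controlled hY.adapted hα s x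
  have hX : AEStronglyMeasurable X P :=
    (hs.mono (𝓕.le s)).add ((((hY.adapted _).mono (𝓕.le _)).sub
      ((hY.adapted _).mono (𝓕.le _))).aestronglyMeasurable)
  have hf := integrable_comp_controlled hY.adapted hα (s + t) f x
  have hΦ : Integrable (fun ω => Φ hc t f (X ω)) P := (Φ hc t f).integrable_comp hX
  have h_cost : runningCost c P α s + ∫⁻ ω, ENNReal.ofReal (k ω) ∂P ≤
      runningCost c P α (s + t) := by
    refine le_trans ?_ (runningCost_add_lintegral_le c P α s t)
    gcongr 1
    exact lintegral_mono_ae (hα.2.2.mono fun ω hω =>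
      ofReal_controlled_sub_Φ_le_lintegral hc (hω (s + t)) f x)
  have h_ne_top := ne_top_of_le_ne_top h_fin h_cost
  have hs_fin : runningCost c P α s ≠ ∞ := ne_top_of_le_ne_top h_ne_top le_self_add
  have h_cost_real := ENNReal.toReal_mono h_fin h_cost
  rw [ENNReal.toReal_add hs_fin (ne_top_of_le_ne_top h_ne_top le_add_self)] at h_cost_real
  have h_gain : ∫ ω, k ω ∂P ≤ (∫⁻ ω, ENNReal.ofReal (k ω) ∂P).toReal := by
    have hk : Integrable k P := hf.sub hΦ
    rw [integral_eq_lintegral_pos_part_sub_lintegral_neg_part hk]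
    exact sub_le_self _ ENNReal.toReal_nonneg
  have h_int : ∫ ω, k ω ∂P = ∫ ω, f (controlled Y α (s + t) x ω) ∂P -
      ∫ ω, transition ν (Φ hc t f) (controlled Y α s x ω) ∂P := by
    rw [integral_sub hf hΦ, hY.integral_comp_add_sub hν s (Φ hc t f) hs]
  refine le_trans ?_ (le_V hc hY hα hs_fin (transition ν (Φ hc t f)) x)
  linarith

end ValueFunction

/-! ### Switching to a constant control -/

section Selection

variable {E : Type*} [NormedAddCommGroup E] [NormedSpace ℝ E]
  [TopologicalSpace.SeparableSpace E] [MeasurableSpace E] [BorelSpace E] {c : E → ℝ≥0∞}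

/-- By uniform continuity, a displacement which is nearly optimal at a point is nearly optimal in a
whole ball, so countably many values suffice. -/
theorem exists_measurable_Φ_sub_le (hc : IsCost c) (t : ℝ≥0) (f : UCb E) {ε : ℝ} (hε : 0 < ε) :
    ∃ b : E → E, Measurable b ∧ Measurable (fun y => c (b y)) ∧
      ∀ y, c (b y) ≠ ∞ ∧ Φ hc t f y - ε ≤ f (y + t • b y) - t * (c (b y)).toReal := by
  classical
  have hε3 : 0 < ε / 3 := by positivity
  choose a ha_ne ha using fun y => exists_lt_Φ hc t f y hε3
  obtain ⟨δ₁, hδ₁, hf⟩ := f.exists_modulus (ε / 3) hε3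
  obtain ⟨δ₂, hδ₂, hΦ⟩ := (Φ hc t f).exists_modulus (ε / 3) hε3
  let q := TopologicalSpace.denseSeq E
  have h_dense (y : E) : ∃ n, dist y (q n) < min δ₁ δ₂ :=
    (TopologicalSpace.denseRange_denseSeq E).exists_dist_lt y (lt_min hδ₁ hδ₂)
  let i (y : E) : ℕ := Nat.find (h_dense y)
  have hi : Measurable i :=
    measurable_find h_dense fun n => (Metric.isOpen_ball (x := q n)).measurableSet
  refine ⟨fun y => a (q (i y)), (measurable_from_nat (f := fun n => a (q n))).comp hi,
    (measurable_from_nat (f := fun n => c (a (q n)))).comp hi, fun y => ⟨ha_ne _, ?_⟩⟩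
  have hy : dist y (q (i y)) < min δ₁ δ₂ := Nat.find_spec (h_dense y)
  have hf_near := hf _ _ (hy.trans_le (min_le_left _ _)) (t • a (q (i y)))
  have hΦ_near := hΦ _ _ (hy.trans_le (min_le_right _ _)) 0
  rw [add_zero, add_zero] at hΦ_near
  linarith [ha (q (i y)), (abs_le.1 hf_near).1, (abs_le.1 hΦ_near).2]

end Selection

section SwitchControl

variable {Ω : Type*} {E : Type*} {Y α : ℝ≥0 → Ω → E} {b : Ω → E} {s : ℝ≥0} {ω : Ω}

/-- The control that follows `α` up to and including time `s` and is frozen at `b` afterwards. -/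
noncomputable def switchControl (s : ℝ≥0) (α : ℝ≥0 → Ω → E) (b : Ω → E) (u : ℝ≥0) : Ω → E :=
  if u ≤ s then α u else b

theorem switchControl_toNNReal_of_mem_Ioc_zero {u : ℝ} (hu : u ∈ Set.Ioc 0 (s : ℝ)) :
    switchControl s α b u.toNNReal = α u.toNNReal :=
  if_pos (Real.toNNReal_le_iff_le_coe.2 hu.2)

theorem switchControl_toNNReal_of_mem_Ioc {u r : ℝ} (hu : u ∈ Set.Ioc (s : ℝ) r) :
    switchControl s α b u.toNNReal = b :=
  if_neg (by rw [Real.toNNReal_le_iff_le_coe]; exact not_le.2 hu.1)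

theorem lintegral_comp_switchControl (c : E → ℝ≥0∞) (s t : ℝ≥0) (α : ℝ≥0 → Ω → E) (b : Ω → E)
    (ω : Ω) :
    ∫⁻ u in Set.Ioc 0 ((s + t : ℝ≥0) : ℝ), c (switchControl s α b u.toNNReal ω) =
      (∫⁻ u in Set.Ioc 0 (s : ℝ), c (α u.toNNReal ω)) + t * c (b ω) := by
  rw [lintegral_Ioc_add]
  congr 1
  · exact setLIntegral_congr_fun measurableSet_Ioc fun u hu => by
      simp only [switchControl_toNNReal_of_mem_Ioc_zero hu]
  · rw [← volume_Ioc_add s t, mul_comm, ← setLIntegral_const]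
    exact setLIntegral_congr_fun measurableSet_Ioc fun u hu => by
      simp only [switchControl_toNNReal_of_mem_Ioc hu]

theorem runningCost_switchControl_add {m : MeasurableSpace Ω} {P : Measure Ω} {c : E → ℝ≥0∞}
    (hcb : Measurable fun ω => c (b ω)) (α : ℝ≥0 → Ω → E) (s t : ℝ≥0) :
    runningCost c P (switchControl s α b) (s + t) =
      runningCost c P α s + ∫⁻ ω, t * c (b ω) ∂P := by
  simp_rw [runningCost, lintegral_comp_switchControl]
  exact lintegral_add_right _ (hcb.const_mul _)

variable [NormedAddCommGroup E]

theorem integrableOn_switchControl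
    (hα : IntegrableOn (fun u : ℝ => α u.toNNReal ω) (Set.Ioc 0 (s : ℝ))) (t : ℝ) :
    IntegrableOn (fun u : ℝ => switchControl s α b u.toNNReal ω) (Set.Ioc 0 t) := by
  have h_left : IntegrableOn (fun u : ℝ => switchControl s α b u.toNNReal ω) (Set.Ioc 0 (s : ℝ)) :=
    hα.congr_fun (fun u hu => by simp only [switchControl_toNNReal_of_mem_Ioc_zero hu])
      measurableSet_Ioc
  have h_right : IntegrableOn (fun u : ℝ => switchControl s α b u.toNNReal ω)
      (Set.Ioc (s : ℝ) t) :=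
    (integrableOn_const (C := b ω) (by simp)).congr_fun
      (fun u hu => by simp only [switchControl_toNNReal_of_mem_Ioc hu]) measurableSet_Ioc
  exact (h_left.union h_right).mono_set Set.Ioc_subset_Ioc_union_Ioc

theorem switchControl_mem_admissible {m : MeasurableSpace Ω} {P : Measure Ω}
    {𝓕 : Filtration ℝ≥0 m} (hα : α ∈ admissible (E := E) 𝓕 P) (hb : StronglyMeasurable[𝓕 s] b) :
    switchControl s α b ∈ admissible (E := E) 𝓕 P := by
  refine ⟨fun u => ?_, ?_, hα.2.2.mono fun ω hω t => integrableOn_switchControl (hω s) t⟩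
  · rcases le_or_gt u s with hu | hu
    · simpa only [switchControl, if_pos hu] using hα.1 u
    · simpa only [switchControl, if_neg hu.not_ge] using hb.mono (𝓕.mono hu.le)
  · have h_eq : Function.uncurry (switchControl s α b) = fun p : ℝ≥0 × Ω =>
        if p.1 ≤ s then Function.uncurry α p else b p.2 := by
      ext p
      simp only [Function.uncurry, switchControl]
      split_ifs <;> rfl
    rw [h_eq]
    exact hα.2.1.ite (measurableSet_le measurable_fst measurable_const)
      ((hb.mono (𝓕.le s)).comp_measurable measurable_snd)

variable [NormedSpace ℝ E] [CompleteSpace E]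

theorem controlled_switchControl_add
    (hα : IntegrableOn (fun u : ℝ => α u.toNNReal ω) (Set.Ioc 0 (s : ℝ))) (t : ℝ≥0) (x : E) :
    controlled Y (switchControl s α b) (s + t) x ω =
      controlled Y α s x ω + t • b ω + (Y (s + t) ω - Y s ω) := by
  have h_left : ∫ u in Set.Ioc 0 (s : ℝ), switchControl s α b u.toNNReal ω =
      ∫ u in Set.Ioc 0 (s : ℝ), α u.toNNReal ω :=
    setIntegral_congr_fun measurableSet_Ioc fun u hu => by
      simp only [switchControl_toNNReal_of_mem_Ioc_zero hu]
  have h_right : ∫ u in Set.Ioc (s : ℝ) ((s + t : ℝ≥0) : ℝ), switchControl s α b u.toNNReal ω =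
      t • b ω := by
    have h_const : ∫ _ in Set.Ioc (s : ℝ) ((s + t : ℝ≥0) : ℝ), b ω = t • b ω := by
      rw [setIntegral_const, measureReal_def, volume_Ioc_add, ENNReal.coe_toReal, NNReal.smul_def]
    rw [← h_const]
    exact setIntegral_congr_fun measurableSet_Ioc fun u hu => by
      simp only [switchControl_toNNReal_of_mem_Ioc hu]
  rw [controlled, controlled, integral_Ioc_add s t (integrableOn_switchControl hα _), h_left,
    h_right]
  abel

end SwitchControl

section ValueFunction

variable {Ω : Type*} {m : MeasurableSpace Ω} {P : Measure Ω} [IsProbabilityMeasure P]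
  {E : Type*} [NormedAddCommGroup E] [NormedSpace ℝ E] [CompleteSpace E]
  [TopologicalSpace.SeparableSpace E] [MeasurableSpace E] [BorelSpace E]
  {𝓕 : Filtration ℝ≥0 m} {Y : ℝ≥0 → Ω → E} {c : E → ℝ≥0∞} {ν : ProbabilityMeasure E} {s t : ℝ≥0}

theorem integral_transition_sub_le_V_add (hc : IsCost c) (hY : IsLevyProcess 𝓕 P Y)
    (hν : HasLaw (Y t) (ν : Measure E) P) {α : ℝ≥0 → Ω → E} (hα : α ∈ admissible (E := E) 𝓕 P)
    (h_fin : runningCost c P α s ≠ ∞) {b : Ω → E} (hb : StronglyMeasurable[𝓕 s] b)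
    (hcb : Measurable fun ω => c (b ω)) (hb_fin : ∫⁻ ω, t * c (b ω) ∂P ≠ ∞) (f : UCb E) (x : E) :
    ∫ ω, transition ν f (controlled Y α s x ω + t • b ω) ∂P -
        ((runningCost c P α s).toReal + ∫ ω, (t * c (b ω)).toReal ∂P) ≤ V hc hY (s + t) f x := by
  have h_cost := runningCost_switchControl_add (P := P) hcb α s t
  have h_path : (fun ω => f (controlled Y (switchControl s α b) (s + t) x ω)) =ᵐ[P]
      fun ω => f (controlled Y α s x ω + t • b ω + (Y (s + t) ω - Y s ω)) :=
    hα.2.2.mono fun ω hω => by simp only [controlled_switchControl_add (hω s) t x]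
  have h_adapted : AEStronglyMeasurable[𝓕 s] (fun ω => controlled Y α s x ω + t • b ω) P :=
    (aestronglyMeasurable_controlled hY.adapted hα s x).add (hb.const_smul t).aestronglyMeasurable
  have h_V := le_V hc hY (switchControl_mem_admissible hα hb)
    (by rw [h_cost]; exact ENNReal.add_ne_top.2 ⟨h_fin, hb_fin⟩) f x
  rwa [h_cost, ENNReal.toReal_add h_fin hb_fin, integral_congr_ae h_path,
    hY.integral_comp_add_sub hν s f h_adapted,
    ← integral_toReal (hcb.const_mul _).aemeasurable
      (ae_lt_top (hcb.const_mul _) hb_fin)] at h_V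

theorem V_Φ_transition_le (hc : IsCost c) (hY : IsLevyProcess 𝓕 P Y)
    (hν : HasLaw (Y t) (ν : Measure E) P) (s : ℝ≥0) (f : UCb E) :
    V hc hY s (Φ hc t (transition ν f)) ≤ V hc hY (s + t) f := fun x => by
  have : SecondCountableTopology E := UniformSpace.secondCountable_of_separable E
  refine V_le hc hY fun α hα h_fin => le_of_forall_pos_le_add fun ε hε => ?_
  set g := transition ν f
  obtain ⟨b, hb, hcb, hb_opt⟩ := exists_measurable_Φ_sub_le hc t g hε
  have hs := aestronglyMeasurable_controlled hY.adapted hα s x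
  have ⟨X, hX, hX_eq⟩ := hs
  have hbX : StronglyMeasurable[𝓕 s] fun ω => b (X ω) := (hb.comp hX.measurable).stronglyMeasurable
  have hcbX : Measurable fun ω => c (b (X ω)) := hcb.comp (hX.mono (𝓕.le s)).measurable
  have h_bound (y : E) : t * c (b y) ≤ ENNReal.ofReal (2 * ‖g.1‖ + ε) := by
    have h_self : g y ≤ Φ hc t g y := self_le_Φ hc t g y
    rw [ENNReal.le_ofReal_iff_toReal_le (ENNReal.mul_ne_top ENNReal.coe_ne_top (hb_opt y).1)
      (by positivity), ENNReal.toReal_mul, ENNReal.coe_toReal]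
    linarith [(hb_opt y).2, (abs_le.1 (g.abs_sub_le (y + t • b y) y)).2]
  have hb_fin : ∫⁻ ω, t * c (b (X ω)) ∂P ≠ ∞ :=
    ne_top_of_le_ne_top (by simp) (lintegral_mono fun ω => h_bound (X ω))
  have h_V := integral_transition_sub_le_V_add hc hY hν hα h_fin hbX hcbX hb_fin f x
  have hΦ := integrable_comp_controlled hY.adapted hα s (Φ hc t g) x
  have h_cost := integrable_toReal_of_lintegral_ne_top (hcbX.const_mul t).aemeasurable hb_fin
  have hg : Integrable (fun ω => g (controlled Y α s x ω + t • b (X ω))) P := g.integrable_comp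
    ((hs.mono (𝓕.le s)).add ((hbX.mono (𝓕.le s)).const_smul t).aestronglyMeasurable)
  have h_opt : ∫ ω, (Φ hc t g (controlled Y α s x ω) - ε) ∂P ≤
      ∫ ω, (g (controlled Y α s x ω + t • b (X ω)) - (t * c (b (X ω))).toReal) ∂P := by
    refine integral_mono_ae (hΦ.sub (integrable_const ε)) (hg.sub h_cost) ?_
    filter_upwards [hX_eq] with ω hω
    simpa [hω] using (hb_opt (X ω)).2
  rw [integral_sub hΦ (integrable_const ε), integral_sub hg h_cost] at h_opt
  simp only [integral_const, probReal_univ, one_smul] at h_opt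
  refine le_trans ?_ (add_le_add_left h_V ε)
  linarith

end ValueFunction

/-! ### Dynamic programming -/

theorem exists_nsmul_eq_of_eventually {p : ℝ≥0 → Prop} (hp : ∀ᶠ h in 𝓝[>] 0, p h) (t : ℝ≥0) :
    ∃ (n : ℕ) (h : ℝ≥0), 0 < h ∧ n • h = t ∧ p h := by
  rcases eq_or_ne t 0 with rfl | ht
  · obtain ⟨h, hh, h_pos⟩ := (hp.and self_mem_nhdsWithin).exists
    exact ⟨0, h, h_pos, zero_nsmul h, hh⟩
  have h_pos (n : ℕ) : 0 < t / (n + 1) := div_pos (pos_iff_ne_zero.2 ht) n.cast_add_one_pos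
  have h_lim : Tendsto (fun n : ℕ => t / (n + 1)) atTop (𝓝[>] 0) := by
    refine tendsto_nhdsWithin_iff.2 ⟨?_, Eventually.of_forall h_pos⟩
    simpa [div_eq_mul_inv] using (tendsto_one_div_add_atTop_nhds_zero_nat (𝕜 := ℝ≥0)).const_mul t
  obtain ⟨n, hn⟩ := (h_lim.eventually hp).exists
  refine ⟨n + 1, t / (n + 1), h_pos n, ?_, hn⟩
  rw [nsmul_eq_mul, Nat.cast_succ, mul_div_cancel₀ _ (by positivity)]

section DynamicProgramming

variable {Ω : Type*} {m : MeasurableSpace Ω} {P : Measure Ω} [IsProbabilityMeasure P]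
  {E : Type*} [NormedAddCommGroup E] [NormedSpace ℝ E] [CompleteSpace E]
  [TopologicalSpace.SeparableSpace E] [MeasurableSpace E] [BorelSpace E]
  {𝓕 : Filtration ℝ≥0 m} {Y : ℝ≥0 → Ω → E} {c : E → ℝ≥0∞} {ν : ProbabilityMeasure E} {h : ℝ≥0}

theorem V_add_nsmul_le (hc : IsCost c) (hY : IsLevyProcess 𝓕 P Y)
    (hν : HasLaw (Y h) (ν : Measure E) P) (s : ℝ≥0) (n : ℕ) (f : UCb E) :
    V hc hY (s + n • h) f ≤ V hc hY s ((transition ν ∘ Φ hc h)^[n] f) := by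
  induction n generalizing f with
  | zero => simp
  | succ n ih =>
    rw [succ_nsmul, ← add_assoc, Function.iterate_succ_apply]
    exact (V_add_le hc hY hν (s + n • h) f).trans (ih _)

theorem V_iterate_le (hc : IsCost c) (hY : IsLevyProcess 𝓕 P Y)
    (hν : HasLaw (Y h) (ν : Measure E) P) (s : ℝ≥0) (n : ℕ) (f : UCb E) :
    V hc hY s ((Φ hc h ∘ transition ν)^[n] f) ≤ V hc hY (s + n • h) f := by
  induction n generalizing f with
  | zero => simp
  | succ n ih =>
    rw [succ_nsmul, ← add_assoc, Function.iterate_succ_apply]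
    exact (ih _).trans (V_Φ_transition_le hc hY hν (s + n • h) f)

theorem exists_V_le_V_add_le_V (hc : IsCost c) (hY : IsLevyProcess 𝓕 P Y)
    {μ : ℝ≥0 → ProbabilityMeasure E} (hμ : ∀ t, 0 < t → HasLaw (Y t) (μ t : Measure E) P)
    (t : ℝ≥0) (f : UCb E) {ε : ℝ} (hε : 0 < ε) :
    ∃ g₁ g₂ : UCb E, (∀ s, V hc hY s g₁ ≤ V hc hY (s + t) f) ∧
      (∀ s, V hc hY (s + t) f ≤ V hc hY s g₂) ∧ ∀ x, g₂ x ≤ g₁ x + ε := by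
  obtain ⟨n, h, h_pos, rfl, h_le⟩ := exists_nsmul_eq_of_eventually
    (eventually_iterate_transition_comp_Φ_le hc (hY.tendsto_measureReal hμ) f hε) t
  exact ⟨_, _, fun s => V_iterate_le hc hY (hμ h h_pos) s n f,
    fun s => V_add_nsmul_le hc hY (hμ h h_pos) s n f, h_le n⟩

theorem V_add (hc : IsCost c) (hY : IsLevyProcess 𝓕 P Y) {μ : ℝ≥0 → ProbabilityMeasure E}
    (hμ : ∀ t, 0 < t → HasLaw (Y t) (μ t : Measure E) P) (s t : ℝ≥0) (f : UCb E) :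
    V hc hY (s + t) f = V hc hY s (V hc hY t f) := by
  refine UCb.ext fun x => eq_of_abs_sub_le_all fun ε hε => ?_
  obtain ⟨g₁, g₂, h_lower, h_upper, h_le⟩ := exists_V_le_V_add_le_V hc hY hμ t f hε
  have h₁ : g₁ ≤ V hc hY t f := by simpa only [V_zero, zero_add] using h_lower 0
  have h₂ : V hc hY t f ≤ g₂ := by simpa only [V_zero, zero_add] using h_upper 0
  have hV := isEquivariantMonotone_V hc hY s
  have h_gap : V hc hY s g₂ x ≤ V hc hY s g₁ x + ε := hV.le_add h_le x
  have h_le_value : V hc hY s g₁ x ≤ V hc hY (s + t) f x := h_lower s x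
  have h_value_le : V hc hY (s + t) f x ≤ V hc hY s g₂ x := h_upper s x
  have h_le_comp : V hc hY s g₁ x ≤ V hc hY s (V hc hY t f) x := hV.monotone h₁ x
  have h_comp_le : V hc hY s (V hc hY t f) x ≤ V hc hY s g₂ x := hV.monotone h₂ x
  exact abs_sub_le_iff.2 ⟨by linarith, by linarith⟩

end DynamicProgramming

end HopfLax

theorem mainTheorem2 {E : Type*} [NormedAddCommGroup E] [NormedSpace ℝ E] [CompleteSpace E]
    [TopologicalSpace.SeparableSpace E] [MeasurableSpace E] [BorelSpace E]
    {c : E → ℝ≥0∞} (hc : HopfLax.IsCost c)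
    {Ω : Type*} {m : MeasurableSpace Ω} {P : Measure Ω} [IsProbabilityMeasure P]
    {𝓕 : Filtration ℝ≥0 m} {Y : ℝ≥0 → Ω → E} (hY : HopfLax.IsLevyProcess 𝓕 P Y)
    (μ : ℝ≥0 → ProbabilityMeasure E) (hμ : ∀ t, 0 < t → HasLaw (Y t) (μ t : Measure E) P)
    (s t : ℝ≥0) (f : HopfLax.UCb E) :
    HopfLax.Φ hc (s + t) f = HopfLax.Φ hc s (HopfLax.Φ hc t f) ∧
      HopfLax.J hc μ (s + t) f ≤ HopfLax.J hc μ s (HopfLax.J hc μ t f) ∧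
      HopfLax.I hc μ s (HopfLax.I hc μ t f) ≤ HopfLax.I hc μ (s + t) f ∧
      HopfLax.V hc hY (s + t) f = HopfLax.V hc hY s (HopfLax.V hc hY t f) :=
  have hμ_conv (s t : ℝ≥0) (hs : 0 < s) (ht : 0 < t) :
      (μ (s + t) : Measure E) = (μ s : Measure E) ∗ (μ t : Measure E) :=
    (hμ _ (by positivity)).map_eq.symm.trans (hY.hasLaw_add (hμ s hs) (hμ t ht)).map_eq
  ⟨HopfLax.Φ_add hc s t f, HopfLax.J_add_le hc hμ_conv s t f, HopfLax.I_I_le hc hμ_conv s t f,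
    HopfLax.V_add hc hY hμ s t f⟩
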